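/- Let $\Lambda=[0,1]\times(\mathbb R/\mathbb Z)^2$, $e=(1,0,0)$, and let $\Gamma=1$ on $\{0\}\times(\mathbb R/\mathbb Z)^2$, $\Gamma=-1$ on $\{1\}\times(\mathbb R/\mathbb Z)^2$, so that $\Gamma(x)e$ is the inner normal at $x\in\partial\Lambda$. Put $\Sigma^+=\{(x,v)\in\partial\Lambda\times\mathbb R^3:\ \Gamma(x)\,v\cdot e>0\}$ and $c_3=\left(\int_{\mathbb S^2}(\omega\cdot e)_-\,d\omega\right)^{-1}=1/\pi$. For $t\ge 0$ let $T(t)$ be the transport semigroup of one point particle with diffuse reflection in angle: $(T(t)g)(z)=\mathbb E\,[g(\varphi^{-t}(z,\bar\omega))]$, where $\bar\omega=(\omega^k)_{k\ge1}$ is a sequence of independent random directions in $\mathbb S^2$ with law $c_3(\omega\cdot e)_-d\omega$, and $\varphi^{-t}(z,\bar\omega)$ is obtained by following the particle from $z=(x,v)$ backward in time along straight lines during the time $t$, its velocity $v$ being replaced by $|v|\,\Gamma(y)\,\omega^k$ when it meets $\partial\Lambda$, at $y$, for the $k$-th time (before the time $t$ has elapsed). A particle with $v\cdot e=0$ is not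 reflected and moves freely. Let $$Q(g,g)(x,v)=\int_{\mathbb S^2\times\mathbb R^3}\Big(g(x,v')g(x,v_*')\,(\nu\cdot(v_*-v))_+-g(x,v)g(x,v_*)\,(\nu\cdot(v_*-v))_-\Big)\,d\nu\,dv_*,$$ with $v'=v-(\nu\cdot(v-v_*))\nu$ and $v_*'=v_*+(\nu\cdot(v-v_*))\nu$. A solution on $[0,T]$ of the Boltzmann equation with diffusion in angle, with initial datum $f_0$, is a measurable function $f:[0,T]\times\Lambda\times\mathbb R^3\to\mathbb R$ such that $|f(t,x,v)|\le C'e^{-\beta'|v|^2/2}$ on $[0,T]\times\Lambda\times\mathbb R^3$ for some $\beta'>0$ and $C'$, and $$f(t)=T(t)f_0+\int_0^t T(t-\tau)\,Q(f(\tau),f(\tau))\,d\tau\qquad(0\le t\le T)$$ at every point of $\Lambda\times\mathbb R^3$. **Proposition.** Let $\beta>0$ and $C\in\mathbb R$. There is a time $T_0>0$, depending only on $\beta$ and $C$, such that the following holds for every continuous $f_0:\Lambda\times\mathbb R^3\to\mathbb R$ with $|f_0(x,v)|\le Ce^{-\beta|v|^2/2}$ that satisfies the compatibility condition $$f_0(x,v)=\int_{\mathbb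 S^2}f_0(x,|v|\omega)\,c_3\,(\Gamma(x)\,\omega\cdot e)_-\,d\omega\qquad\text{for all }(x,v)\in\Sigma^+.$$ The Boltzmann equation with diffusion in angle has a solution on $[0,T_0]$ with initial datum $f_0$. Moreover, for every $T$ there is at most one solution on $[0,T]$ with initial datum $f_0$, and if $f$ is such a solution, then $(t,x,v)\mapsto f(t,x,v)$ is continuous on $[0,T]\times\big((\Lambda\times\mathbb R^3)\setminus\mathcal G\big)$, where $\mathcal G=\{(x,v):\ x\in\partial\Lambda,\ v\cdot e=0,\ v\neq0\}$ is the set of grazing configurations. -/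

import Mathlib

open MeasureTheory Set

noncomputable section

namespace DiffuseBoltzmann

/-- Velocities: `ℝ³` with its Euclidean norm. The first coordinate is the one along `e = (1,0,0)`. -/
abbrev Vel : Type := EuclideanSpace ℝ (Fin 3)

/-- The spatial domain `Λ = [0,1] × (ℝ/ℤ)²`. -/
abbrev Space : Type := Set.Icc (0 : ℝ) 1 × UnitAddCircle × UnitAddCircle

/-- The one-particle phase space `Λ × ℝ³`. -/
abbrev Phase : Type := Space × Vel

/-- The unit sphere `S²`. -/
abbrev Dir : Type := Metric.sphere (0 : Vel) 1

/-- The surface measure `dω` on the sphere `S²`. -/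
def surf : Measure Dir := (volume : Measure Vel).toSphere

instance : IsFiniteMeasure surf := by
  unfold surf; infer_instance

instance : surf.IsOpenPosMeasure := by
  unfold surf; infer_instance

/-- The negative part `(ω · e)₋`. -/
def negPart (ω : Vel) : ℝ := max (-(ω 0)) 0

/-- The normalization constant `c₃ = (∫_{S²} (ω · e)₋ dω)⁻¹`. -/
def c3 : ℝ := (∫ ω : Dir, negPart ω ∂surf)⁻¹

theorem continuous_negPart : Continuous fun ω : Dir => negPart ω := by
  unfold negPart; fun_prop

theorem negPart_nonneg (ω : Vel) : 0 ≤ negPart ω := le_max_right _ _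

theorem integrable_negPart : Integrable (fun ω : Dir => negPart ω) surf :=
  continuous_negPart.integrable_of_hasCompactSupport (HasCompactSupport.of_compactSpace _)

theorem integral_negPart_pos : 0 < ∫ ω : Dir, negPart ω ∂surf := by
  refine integral_pos_of_integrable_nonneg_nonzero
    (x := ⟨-EuclideanSpace.single (0 : Fin 3) (1 : ℝ), by simp⟩) continuous_negPart
    integrable_negPart (fun ω => negPart_nonneg ω) ?_
  simp [negPart]

/-- The law `c₃ (ω · e)₋ dω` of a single reflection direction. -/
def reflectionLaw : Measure Dir :=
  surf.withDensity fun ω => ENNReal.ofReal (c3 * negPart ω)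

instance : IsProbabilityMeasure reflectionLaw := by
  constructor
  have hc : 0 ≤ c3 := inv_nonneg.2 integral_negPart_pos.le
  rw [reflectionLaw, withDensity_apply _ MeasurableSet.univ, Measure.restrict_univ,
    ← ofReal_integral_eq_lintegral_ofReal (integrable_negPart.const_mul c3)
      (Filter.Eventually.of_forall fun ω => mul_nonneg hc (negPart_nonneg ω)),
    integral_const_mul, c3, inv_mul_cancel₀ integral_negPart_pos.ne', ENNReal.ofReal_one]

/-- The law of the sequence of independent reflection directions met by a particle followed
backward in time, each distributed according to `c₃ (ω · e)₋ dω`. -/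
def reflectionsLaw : Measure (ℕ → Dir) := Measure.infinitePi fun _ => reflectionLaw

/-- The position lies on `∂Λ = {0,1} × (ℝ/ℤ)²`. -/
def OnBoundary (x : Space) : Prop := (x.1 : ℝ) = 0 ∨ (x.1 : ℝ) = 1

/-- The sign `Γ` on the boundary: `Γ = 1` on `{0} × (ℝ/ℤ)²` and `Γ = -1` on `{1} × (ℝ/ℤ)²`,
so that `Γ(x) e` is the inner normal (the value away from the boundary is never used). -/
def bdrySign (x : Space) : ℝ := if (x.1 : ℝ) = 0 then 1 else -1

/-- The outgoing boundary set `Σ⁺ = {(x,v) : x ∈ ∂Λ, v · n(x) > 0}`. -/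
def outgoing : Set Phase := {z | OnBoundary z.1 ∧ 0 < bdrySign z.1 * z.2 0}

/-- The grazing set: boundary points with a nonzero velocity tangent to the boundary. -/
def grazing : Set Phase := {z | OnBoundary z.1 ∧ z.2 0 = 0 ∧ z.2 ≠ 0}

/-- The position `x - s v`. It is only evaluated for times `s` at which this point is still
in `Λ`, and then the projection to `[0,1]` does nothing. -/
def moveBack (s : ℝ) (x : Space) (v : Vel) : Space :=
  (Set.projIcc 0 1 zero_le_one ((x.1 : ℝ) - s * v 0),
    x.2.1 - ((s * v 1 : ℝ) : UnitAddCircle), x.2.2 - ((s * v 2 : ℝ) : UnitAddCircle))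

/-- For `v · e ≠ 0`, the time at which the backward free trajectory `s ↦ x - s v` reaches the
wall towards which it moves. -/
def backExit (x : Space) (v : Vel) : ℝ :=
  if 0 < v 0 then (x.1 : ℝ) / v 0 else (1 - (x.1 : ℝ)) / (-(v 0))

open Classical in
/-- The backward dynamics of one point particle. The state `(s, x, v)` consists of the time `s`
that remains to be travelled backward, the position and the velocity. If the particle meets the
boundary before the remaining time has elapsed, it is moved to the boundary point `y`, and its
velocity is replaced by `|v| Γ(y) ω_k`; otherwise the state does not change. -/
def backState (t : ℝ) (z : Phase) (ω : ℕ → Dir) : ℕ → ℝ × Space × Vel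
  | 0 => (t, z.1, z.2)
  | k + 1 =>
    let s := (backState t z ω k).1
    let x := (backState t z ω k).2.1
    let v := (backState t z ω k).2.2
    if v 0 ≠ 0 ∧ backExit x v < s then
      let y := moveBack (backExit x v) x v
      (s - backExit x v, y, (‖v‖ * bdrySign y) • (ω k : Vel))
    else (s, x, v)

/-- The point reached from `z` after following the one-particle dynamics backward during the
time `t ≥ 0`. Two reflections are at least a time `1/|v|` apart, so that almost surely there are
at most `⌈t|v|⌉` reflections; after these, the flight is free. -/
def backFlow (t : ℝ) (z : Phase) (ω : ℕ → Dir) : Phase :=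
  let p := backState t z ω ⌈t * ‖z.2‖⌉₊
  (moveBack p.1 p.2.1 p.2.2, p.2.2)

/-- The transport semigroup `T(t)` of one point particle with diffuse reflection in angle,
`(T(t) g)(z) = 𝔼[g(φ^{-t}(z, ω))]`. -/
def transport (t : ℝ) (g : Phase → ℝ) (z : Phase) : ℝ :=
  ∫ ω, g (backFlow t z ω) ∂reflectionsLaw

/-- The velocity `v - (ν · (v - v⋆)) ν`. -/
def scatter (ν : Dir) (v w : Vel) : Vel := v - (inner ℝ (ν : Vel) (v - w)) • (ν : Vel)

/-- The velocity `v⋆ + (ν · (v - v⋆)) ν`. -/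
def scatterStar (ν : Dir) (v w : Vel) : Vel := w + (inner ℝ (ν : Vel) (v - w)) • (ν : Vel)

/-- The gain term, with kernel `(ν · (v⋆ - v))₊`. -/
def collisionGain (g : Phase → ℝ) (z : Phase) : ℝ :=
  ∫ p : Dir × Vel, g (z.1, scatter p.1 z.2 p.2) * g (z.1, scatterStar p.1 z.2 p.2) *
    max (inner ℝ (p.1 : Vel) (p.2 - z.2)) 0 ∂(surf.prod volume)

/-- The loss term, with kernel `(ν · (v⋆ - v))₋`. -/
def collisionLoss (g : Phase → ℝ) (z : Phase) : ℝ :=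
  ∫ p : Dir × Vel, g z * g (z.1, p.2) *
    max (-(inner ℝ (p.1 : Vel) (p.2 - z.2))) 0 ∂(surf.prod volume)

/-- The hard sphere collision operator `Q(g,g)`. -/
def collision (g : Phase → ℝ) (z : Phase) : ℝ := collisionGain g z - collisionLoss g z

/-- The bound `|g(x,v)| ≤ C exp(-β|v|²/2)`. -/
def GaussianBound (β C : ℝ) (g : Phase → ℝ) : Prop :=
  ∀ z : Phase, |g z| ≤ C * Real.exp (-(β / 2) * ‖z.2‖ ^ 2)

/-- The diffuse reflection condition
`g(x,v) = ∫_{S²} g(x,|v|ω) c₃ (Γ(x) ω · e)₋ dω` on `Σ⁺`. -/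
def DiffuseCondition (g : Phase → ℝ) : Prop :=
  ∀ z ∈ outgoing, g z =
    ∫ ω : Dir, g (z.1, ‖z.2‖ • (ω : Vel)) * (c3 * negPart (bdrySign z.1 • (ω : Vel))) ∂surf

/-- `f` solves on `[0,T]` the Boltzmann equation with diffusion in angle, in integral form,
`f(t) = T(t) f₀ + ∫₀ᵗ T(t-τ) Q(f(τ),f(τ)) dτ`, with initial datum `f₀`, in the class of
measurable functions that are bounded by a Gaussian uniformly in time. -/
structure IsSolution (T : ℝ) (f₀ : Phase → ℝ) (f : ℝ → Phase → ℝ) : Prop where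
  measurable : Measurable fun p : Set.Icc (0 : ℝ) T × Phase => f p.1 p.2
  gaussian : ∃ β > 0, ∃ C, ∀ t ∈ Set.Icc (0 : ℝ) T, GaussianBound β C (f t)
  mild : ∀ t ∈ Set.Icc (0 : ℝ) T, ∀ z : Phase,
    f t z = transport t f₀ z + ∫ τ in (0 : ℝ)..t, transport (t - τ) (collision (f τ)) z

end DiffuseBoltzmann

end

/-! Existence and uniqueness come from a contraction in Gaussian-weighted sup norms. Reflections
preserve speed, so `transport` preserves every bound depending on `‖v‖` only. Conservation of energy
turns the product of two Gaussians after a collision into the product before it, so `collision` maps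
Gaussian bounds to Gaussian bounds up to a factor `1 + ‖v‖`, the growth of the hard sphere kernel.
This loss is recovered by letting the Gaussian rate decrease linearly in time, from `b` to `b / 2`
over a step `δ` (`rate`): with `c = b / (2 * δ)`, the source at time `τ` carries an extra factor
`exp (-(c / 2) ‖v‖² (t - τ))`, and the time integral of `‖v‖²` times this factor is at most `2 / c =
4 * δ / b`, whatever `v` is. For small `δ` the mild map therefore contracts with constant `1 / 2`
(`mildMap_contraction`). Picard iteration from zero gives a solution (`exists_isSolution`). Two
solutions share a Gaussian bound on all of `[0,T]`, so a fixed step can be repeated until `T` is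
reached (`IsSolution.unique`).

Continuity off the grazing set needs three facts. The transport of `f₀` is continuous there: the
number of reflections is locally bounded, and one inducts on it by splitting at the first
reflection. A jump could appear where the travel time equals the exit time, and the compatibility
condition removes exactly this jump (`stepTransport_succ_of_diffuse`, `continuousOn_stepTransport`).
In the Duhamel term the time integral smooths such jumps (`continuousOn_stepDuhamel`). Finally,
`collision` preserves continuity off the grazing set, because almost every collision produces
velocities that are not tangent to the walls (`ae_scatter_ne_zero`, `continuousOn_collision`). So
the mild map preserves continuity, and a given solution is, step by step in time, a uniform limit of
continuous iterates (`IsSolution.continuousOn_step`). -/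

noncomputable section

namespace DiffuseBoltzmann

/-! ### The backward flow -/

/-- The first boundary point met backward in time. -/
def hitPoint (z : Phase) : Space := moveBack (backExit z.1 z.2) z.1 z.2

/-- The phase point right behind the first reflection, with reflection direction `ω`. -/
def reflectPt (z : Phase) (ω : Dir) : Phase :=
  (hitPoint z, (‖z.2‖ * bdrySign (hitPoint z)) • (ω : Vel))

/-- The backward trajectory of duration `t` from `z` meets the boundary. -/
def Reflects (t : ℝ) (z : Phase) : Prop := z.2 0 ≠ 0 ∧ backExit z.1 z.2 < t

/-- The flow with at most `n` reflections. -/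
def stepFlow (n : ℕ) (t : ℝ) (z : Phase) (ω : ℕ → Dir) : Phase :=
  (moveBack (backState t z ω n).1 (backState t z ω n).2.1 (backState t z ω n).2.2,
    (backState t z ω n).2.2)

theorem stepFlow_zero (t : ℝ) (z : Phase) (ω : ℕ → Dir) :
    stepFlow 0 t z ω = (moveBack t z.1 z.2, z.2) := rfl

theorem backFlow_eq_stepFlow (t : ℝ) (z : Phase) (ω : ℕ → Dir) :
    backFlow t z ω = stepFlow ⌈t * ‖z.2‖⌉₊ t z ω := rfl

theorem backState_succ_of_reflects {t : ℝ} {z : Phase} {ω : ℕ → Dir} {k : ℕ}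
    (h : Reflects (backState t z ω k).1 (backState t z ω k).2) :
    backState t z ω (k + 1) = ((backState t z ω k).1 -
      backExit (backState t z ω k).2.1 (backState t z ω k).2.2,
      reflectPt (backState t z ω k).2 (ω k)) := by
  rw [backState]
  exact if_pos h

theorem backState_succ_of_not_reflects {t : ℝ} {z : Phase} {ω : ℕ → Dir} {k : ℕ}
    (h : ¬Reflects (backState t z ω k).1 (backState t z ω k).2) :
    backState t z ω (k + 1) = backState t z ω k := by
  rw [backState]
  exact if_neg h

theorem backState_of_not_reflects {t : ℝ} {z : Phase} (ω : ℕ → Dir) (h : ¬Reflects t z) (k : ℕ) :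
    backState t z ω k = (t, z) := by
  induction k with
  | zero => rfl
  | succ k ih =>
    rw [backState_succ_of_not_reflects (by rw [ih]; exact h), ih]

/-- The recursion defining `backState` peels off the last reflection; this peels off the first one
and shifts the directions. All later inductions on the number of reflections rest on this
Markov-type form. -/
theorem backState_one_add_of_reflects {t : ℝ} {z : Phase} (ω : ℕ → Dir) (h : Reflects t z) (k : ℕ) :
    backState t z ω (k + 1) =
      backState (t - backExit z.1 z.2) (reflectPt z (ω 0)) (fun j => ω (j + 1)) k := by
  induction k with
  | zero => exact backState_succ_of_reflects (k := 0) h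
  | succ k ih =>
    by_cases hr : Reflects (backState t z ω (k + 1)).1 (backState t z ω (k + 1)).2
    · rw [backState_succ_of_reflects hr]
      rw [ih] at hr ⊢
      rw [backState_succ_of_reflects hr]
    · rw [backState_succ_of_not_reflects hr]
      rw [ih] at hr ⊢
      rw [backState_succ_of_not_reflects hr]

theorem stepFlow_of_not_reflects {t : ℝ} {z : Phase} (ω : ℕ → Dir) (h : ¬Reflects t z) (n : ℕ) :
    stepFlow n t z ω = (moveBack t z.1 z.2, z.2) := by
  rw [stepFlow, backState_of_not_reflects ω h]

theorem stepFlow_succ_of_reflects {t : ℝ} {z : Phase} (ω : ℕ → Dir) (h : Reflects t z) (n : ℕ) :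
    stepFlow (n + 1) t z ω =
      stepFlow n (t - backExit z.1 z.2) (reflectPt z (ω 0)) (fun j => ω (j + 1)) := by
  rw [stepFlow, backState_one_add_of_reflects ω h, stepFlow]

/-! ### Geometry of a single flight -/

theorem backExit_nonneg (x : Space) (v : Vel) : 0 ≤ backExit x v := by
  have h0 := x.1.2.1
  have h1 := x.1.2.2
  unfold backExit
  split_ifs with h
  · positivity
  · exact div_nonneg (by linarith) (by linarith [not_lt.1 h])

theorem abs_bdrySign (x : Space) : |bdrySign x| = 1 := by
  unfold bdrySign
  split_ifs <;> simp

theorem norm_reflectPt (z : Phase) (ω : Dir) : ‖(reflectPt z ω).2‖ = ‖z.2‖ := by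
  have : ‖(ω : Vel)‖ = 1 := by simp
  rw [reflectPt, norm_smul, this, mul_one, norm_mul, norm_norm, Real.norm_eq_abs (bdrySign _),
    abs_bdrySign, mul_one]

theorem hitPoint_coord {z : Phase} (h : z.2 0 ≠ 0) :
    ((hitPoint z).1 : ℝ) = if 0 < z.2 0 then 0 else 1 := by
  have e : (hitPoint z).1 = projIcc 0 1 zero_le_one
      ((z.1.1 : ℝ) - backExit z.1 z.2 * z.2 0) := rfl
  rw [e]
  unfold backExit
  split_ifs with h'
  · rw [div_mul_cancel₀ _ h, sub_self, projIcc_left]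
  · rw [div_neg, neg_mul, div_mul_cancel₀ _ h, sub_neg_eq_add, add_sub_cancel, projIcc_right]

theorem onBoundary_hitPoint {z : Phase} (h : z.2 0 ≠ 0) : OnBoundary (hitPoint z) := by
  unfold OnBoundary
  rw [hitPoint_coord h]
  split_ifs <;> simp

theorem bdrySign_hitPoint {z : Phase} (h : z.2 0 ≠ 0) :
    bdrySign (hitPoint z) = if 0 < z.2 0 then 1 else -1 := by
  unfold bdrySign
  rw [hitPoint_coord h]
  split_ifs <;> simp_all

/-- A particle followed backward reaches the wall from which its velocity points inward, so the
compatibility condition is available at every first hit. -/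
theorem hitPoint_mem_outgoing {z : Phase} (h : z.2 0 ≠ 0) : (hitPoint z, z.2) ∈ outgoing := by
  refine ⟨onBoundary_hitPoint h, ?_⟩
  show 0 < bdrySign (hitPoint z) * z.2 0
  rw [bdrySign_hitPoint h]
  split_ifs with h'
  · simp [h']
  · have := lt_of_le_of_ne (not_lt.1 h') h
    linarith

theorem abs_apply_le_norm (v : Vel) (i : Fin 3) : |v i| ≤ ‖v‖ := PiLp.norm_apply_le v i

theorem norm_pos_of_apply_ne {v : Vel} (h : v 0 ≠ 0) : 0 < ‖v‖ :=
  (abs_pos.2 h).trans_le (abs_apply_le_norm v 0)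

theorem reflectPt_apply_zero_ne {z : Phase} {ω : Dir} (h : z.2 0 ≠ 0) (hω : (ω : Vel) 0 < 0) :
    (reflectPt z ω).2 0 ≠ 0 := by
  have h1 := norm_pos_of_apply_ne h
  have h2 : bdrySign (hitPoint z) ≠ 0 := by
    rw [← abs_pos, abs_bdrySign]; exact one_pos
  simp [reflectPt, h2, hω.ne, norm_ne_zero_iff.1 h1.ne']

/-- With `ω · e < 0` the backward flight after a reflection leaves the wall and must cross the whole
width `1` with normal speed at most `‖v‖`. -/
theorem one_le_backExit_reflectPt {z : Phase} {ω : Dir} (h : z.2 0 ≠ 0) (hω : (ω : Vel) 0 < 0) :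
    1 ≤ backExit (reflectPt z ω).1 (reflectPt z ω).2 * ‖z.2‖ := by
  have h1 := norm_pos_of_apply_ne h
  have hn : |(ω : Vel) 0| ≤ 1 := (abs_apply_le_norm ω 0).trans (by simp)
  rw [abs_of_neg hω] at hn
  have e : (reflectPt z ω).2 0 = ‖z.2‖ * bdrySign (hitPoint z) * (ω : Vel) 0 := rfl
  have e1 : ((reflectPt z ω).1.1 : ℝ) = ((hitPoint z).1 : ℝ) := rfl
  unfold backExit
  rw [e, e1, bdrySign_hitPoint h, hitPoint_coord h]
  have hp : 0 < ‖z.2‖ * -(ω : Vel) 0 := mul_pos h1 (by linarith)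
  have hq : ‖z.2‖ * -(ω : Vel) 0 ≤ ‖z.2‖ := by nlinarith
  split_ifs with h2 h3 h3
  · exfalso; linarith
  · rw [sub_zero, mul_one, ← mul_neg, one_div, ← div_eq_inv_mul, one_le_div hp]
    exact hq
  · rw [mul_neg_one, neg_mul, ← mul_neg, one_div, ← div_eq_inv_mul, one_le_div hp]
    exact hq
  · exfalso; linarith

theorem moveBack_zero (x : Space) (v : Vel) : moveBack 0 x v = x := by
  obtain ⟨a, b, c⟩ := x
  simp [moveBack]

theorem continuous_moveBack : Continuous fun p : ℝ × Space × Vel => moveBack p.1 p.2.1 p.2.2 := by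
  have hc : Continuous fun a : ℝ => (a : UnitAddCircle) := AddCircle.continuous_mk' 1
  unfold moveBack
  refine Continuous.prodMk (continuous_projIcc.comp (by fun_prop)) (Continuous.prodMk ?_ ?_)
  · exact (by fun_prop : Continuous fun p : ℝ × Space × Vel => p.2.1.2.1).sub
      (hc.comp (by fun_prop))
  · exact (by fun_prop : Continuous fun p : ℝ × Space × Vel => p.2.1.2.2).sub
      (hc.comp (by fun_prop))

theorem dist_moveBack_le {s : ℝ} (hs : 0 ≤ s) (x : Space) (v : Vel) :
    dist (moveBack s x v) x ≤ s * ‖v‖ := by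
  have key : ∀ i, |s * v i| ≤ s * ‖v‖ := fun i => by
    rw [abs_mul, abs_of_nonneg hs]
    exact mul_le_mul_of_nonneg_left (abs_apply_le_norm v i) hs
  have hcirc : ∀ (a : UnitAddCircle) (r : ℝ), dist (a - (r : UnitAddCircle)) a ≤ |r| := by
    intro a r
    rw [dist_eq_norm, sub_sub_cancel_left, norm_neg]
    exact (QuotientAddGroup.norm_mk_le_norm (S := AddSubgroup.zmultiples (1 : ℝ)) (m := r)).trans
      (Real.norm_eq_abs r).le
  rw [Prod.dist_eq, Prod.dist_eq]
  refine max_le ?_ (max_le ((hcirc _ _).trans (key 1)) ((hcirc _ _).trans (key 2)))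
  refine le_trans ?_ (key 0)
  have h0 := x.1.2.1
  have h1 := x.1.2.2
  show |((projIcc 0 1 zero_le_one ((x.1 : ℝ) - s * v 0) : Icc (0:ℝ) 1) : ℝ) - (x.1 : ℝ)| ≤ _
  rw [coe_projIcc]
  generalize s * v 0 = r
  rw [abs_le]
  constructor
  · rcases le_total 0 r with h | h
    · rw [abs_of_nonneg h]
      rcases min_choice 1 ((x.1:ℝ) - r) with h' | h' <;> rw [h'] <;>
      linarith [le_max_right 0 (1:ℝ), le_max_right 0 ((x.1:ℝ) - r)]
    · rw [abs_of_nonpos h]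
      rcases min_choice 1 ((x.1:ℝ) - r) with h' | h' <;> rw [h'] <;>
      linarith [le_max_right 0 (1:ℝ), le_max_right 0 ((x.1:ℝ) - r)]
  · have : max 0 (min 1 ((x.1:ℝ) - r)) ≤ x.1 + |r| :=
      max_le (by positivity) ((min_le_right _ _).trans (by linarith [neg_abs_le r]))
    linarith

/-! ### Invariants of the backward dynamics -/

theorem norm_backState (t : ℝ) (z : Phase) (ω : ℕ → Dir) (k : ℕ) :
    ‖(backState t z ω k).2.2‖ = ‖z.2‖ := by
  induction k with
  | zero => rfl
  | succ k ih =>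
    by_cases hr : Reflects (backState t z ω k).1 (backState t z ω k).2
    · rw [backState_succ_of_reflects hr, norm_reflectPt, ih]
    · rw [backState_succ_of_not_reflects hr, ih]

theorem norm_stepFlow (n : ℕ) (t : ℝ) (z : Phase) (ω : ℕ → Dir) :
    ‖(stepFlow n t z ω).2‖ = ‖z.2‖ := norm_backState t z ω n

theorem backState_time_nonneg {t : ℝ} (ht : 0 ≤ t) (z : Phase) (ω : ℕ → Dir) (k : ℕ) :
    0 ≤ (backState t z ω k).1 := by
  induction k with
  | zero => exact ht
  | succ k ih =>
    by_cases hr : Reflects (backState t z ω k).1 (backState t z ω k).2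
    · rw [backState_succ_of_reflects hr]
      exact sub_nonneg.2 hr.2.le
    · rwa [backState_succ_of_not_reflects hr]

theorem dist_backState_le (t : ℝ) (z : Phase) (ω : ℕ → Dir) (k : ℕ) :
    dist (backState t z ω k).2.1 z.1 ≤ (t - (backState t z ω k).1) * ‖z.2‖ := by
  induction k with
  | zero => simp [backState]
  | succ k ih =>
    by_cases hr : Reflects (backState t z ω k).1 (backState t z ω k).2
    · rw [backState_succ_of_reflects hr]
      have h1 := dist_moveBack_le (backExit_nonneg (backState t z ω k).2.1 (backState t z ω k).2.2)
        (backState t z ω k).2.1 (backState t z ω k).2.2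
      rw [norm_backState] at h1
      have h2 := dist_triangle (hitPoint (backState t z ω k).2) (backState t z ω k).2.1 z.1
      have h3 : (reflectPt (backState t z ω k).2 (ω k)).1 = hitPoint (backState t z ω k).2 := rfl
      rw [h3]
      unfold hitPoint at h2 ⊢
      linarith
    · rwa [backState_succ_of_not_reflects hr]

theorem dist_stepFlow_le (n : ℕ) {t : ℝ} (ht : 0 ≤ t) (z : Phase) (ω : ℕ → Dir) :
    dist (stepFlow n t z ω).1 z.1 ≤ t * ‖z.2‖ := by
  have h1 := dist_moveBack_le (backState_time_nonneg ht z ω n) (backState t z ω n).2.1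
    (backState t z ω n).2.2
  rw [norm_backState] at h1
  have h2 := dist_backState_le t z ω n
  have h3 := dist_triangle (stepFlow n t z ω).1 (backState t z ω n).2.1 z.1
  unfold stepFlow at h3 ⊢
  linarith

/-- Two reflections are at least the time `1 / ‖v‖` apart. -/
theorem backState_time_le {t : ℝ} {z : Phase} {ω : ℕ → Dir} (hω : ∀ k, (ω k : Vel) 0 < 0) (k : ℕ)
    (h : Reflects (backState t z ω k).1 (backState t z ω k).2) :
    ((backState t z ω k).1 - backExit (backState t z ω k).2.1 (backState t z ω k).2.2) * ‖z.2‖ ≤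
      t * ‖z.2‖ - k := by
  induction k with
  | zero =>
    have := mul_nonneg (backExit_nonneg z.1 z.2) (norm_nonneg z.2)
    simp only [backState, Nat.cast_zero]
    linarith
  | succ k ih =>
    by_cases hr : Reflects (backState t z ω k).1 (backState t z ω k).2
    · have h1 := ih hr
      have h2 := one_le_backExit_reflectPt hr.1 (hω k)
      rw [norm_backState] at h2
      rw [backState_succ_of_reflects hr, sub_mul]
      push_cast
      linarith
    · rw [backState_succ_of_not_reflects hr] at h
      exact absurd h hr

/-- A further reflection would leave strictly positive remaining time, against the bound `t * ‖v‖ -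
n ≤ 0` of `backState_time_le`. The strict inequality in `Reflects` is what makes `n = ⌈t‖v‖⌉`
enough, although the first wall may be met at once. -/
theorem not_reflects_backState {t : ℝ} {z : Phase} {ω : ℕ → Dir} (hω : ∀ k, (ω k : Vel) 0 < 0)
    {n : ℕ} (hn : t * ‖z.2‖ ≤ n) : ¬Reflects (backState t z ω n).1 (backState t z ω n).2 := by
  intro h
  have h1 := backState_time_le hω n h
  have h2 := norm_pos_of_apply_ne h.1
  rw [norm_backState] at h2
  have := mul_pos (sub_pos.2 h.2) h2
  linarith

theorem backFlow_eq_stepFlow_of_le {t : ℝ} {z : Phase} {ω : ℕ → Dir} (hω : ∀ k, (ω k : Vel) 0 < 0)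
    {n : ℕ} (hn : t * ‖z.2‖ ≤ n) : backFlow t z ω = stepFlow n t z ω := by
  have key : ∀ m, ⌈t * ‖z.2‖⌉₊ ≤ m →
      backState t z ω m = backState t z ω ⌈t * ‖z.2‖⌉₊ := by
    intro m hm
    induction m, hm using Nat.le_induction with
    | base => rfl
    | succ m hm ih =>
      rw [backState_succ_of_not_reflects (not_reflects_backState hω (Nat.ceil_le.1 hm)), ih]
  rw [backFlow_eq_stepFlow, stepFlow, stepFlow, key n (Nat.ceil_le.2 hn)]

theorem mem_compl_grazing_of_ne {z : Phase} (h : z.2 0 ≠ 0) : z ∈ grazingᶜ := fun h' => h h'.2.1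

theorem moveBack_mem_compl_grazing (s : ℝ) {z : Phase} (h : z ∈ grazingᶜ) :
    (moveBack s z.1 z.2, z.2) ∈ grazingᶜ := by
  rintro ⟨h1, h2, h3⟩
  refine h ⟨?_, h2, h3⟩
  have e : (moveBack s z.1 z.2).1 = z.1.1 := by
    have h2' : z.2 0 = 0 := h2
    simp [moveBack, h2']
  unfold OnBoundary at h1 ⊢
  rwa [← e]

/-- A reflected velocity has nonzero normal component, so the dynamics never creates grazing
configurations. Continuity off the grazing set can thus be used along trajectories. -/
theorem backState_mem_compl_grazing {t : ℝ} {z : Phase} {ω : ℕ → Dir}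
    (hω : ∀ k, (ω k : Vel) 0 < 0) (h : z ∈ grazingᶜ) (k : ℕ) :
    (backState t z ω k).2 ∈ grazingᶜ := by
  induction k with
  | zero => exact h
  | succ k ih =>
    by_cases hr : Reflects (backState t z ω k).1 (backState t z ω k).2
    · rw [backState_succ_of_reflects hr]
      exact mem_compl_grazing_of_ne (reflectPt_apply_zero_ne hr.1 (hω k))
    · rwa [backState_succ_of_not_reflects hr]

theorem stepFlow_mem_compl_grazing (n : ℕ) (t : ℝ) {z : Phase} {ω : ℕ → Dir}
    (hω : ∀ k, (ω k : Vel) 0 < 0) (h : z ∈ grazingᶜ) : stepFlow n t z ω ∈ grazingᶜ :=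
  moveBack_mem_compl_grazing _ (backState_mem_compl_grazing hω h n)

/-! ### Measurability of the flow -/

theorem measurable_backExit : Measurable fun z : Phase => backExit z.1 z.2 := by
  unfold backExit
  refine Measurable.ite (measurableSet_lt (by fun_prop) (by fun_prop)) ?_ ?_
  · exact Measurable.div (by fun_prop) (by fun_prop)
  · exact Measurable.div (by fun_prop) (by fun_prop)

theorem measurable_bdrySign : Measurable bdrySign := by
  unfold bdrySign
  exact Measurable.ite (measurableSet_eq_fun (by fun_prop) (by fun_prop)) (by fun_prop)
    (by fun_prop)

theorem measurable_hitPoint : Measurable hitPoint :=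
  continuous_moveBack.measurable.comp (measurable_backExit.prodMk measurable_id)

theorem measurable_reflectPt : Measurable fun p : Phase × Dir => reflectPt p.1 p.2 := by
  unfold reflectPt
  have h : Measurable fun p : Phase × Dir => hitPoint p.1 :=
    measurable_hitPoint.comp measurable_fst
  refine h.prodMk (Measurable.smul (Measurable.mul (by fun_prop) (measurable_bdrySign.comp h)) ?_)
  exact measurable_subtype_coe.comp measurable_snd

theorem measurableSet_reflects : MeasurableSet {p : ℝ × Phase | Reflects p.1 p.2} := by
  unfold Reflects
  refine MeasurableSet.inter (s₁ := {p : ℝ × Phase | p.2.2 0 ≠ 0}) ?_ ?_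
  · exact (measurableSet_eq_fun (by fun_prop) (by fun_prop)).compl
  · exact measurableSet_lt (measurable_backExit.comp measurable_snd) measurable_fst

theorem measurable_backState (k : ℕ) :
    Measurable fun p : (ℝ × Phase) × (ℕ → Dir) => backState p.1.1 p.1.2 p.2 k := by
  classical
  induction k with
  | zero => exact measurable_fst
  | succ k ih =>
    have e : (fun p : (ℝ × Phase) × (ℕ → Dir) => backState p.1.1 p.1.2 p.2 (k + 1)) =
        fun p => if Reflects (backState p.1.1 p.1.2 p.2 k).1 (backState p.1.1 p.1.2 p.2 k).2 then
          ((backState p.1.1 p.1.2 p.2 k).1 -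
            backExit (backState p.1.1 p.1.2 p.2 k).2.1 (backState p.1.1 p.1.2 p.2 k).2.2,
            reflectPt (backState p.1.1 p.1.2 p.2 k).2 (p.2 k))
          else backState p.1.1 p.1.2 p.2 k := by
      funext p
      split_ifs with h
      · exact backState_succ_of_reflects h
      · exact backState_succ_of_not_reflects h
    rw [e]
    refine Measurable.ite (ih measurableSet_reflects) (Measurable.prodMk ?_ ?_) ih
    · exact ih.fst.sub (measurable_backExit.comp ih.snd)
    · exact measurable_reflectPt.comp
        (ih.snd.prodMk ((measurable_pi_apply k).comp measurable_snd))

theorem measurable_stepFlow (n : ℕ) :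
    Measurable fun p : (ℝ × Phase) × (ℕ → Dir) => stepFlow n p.1.1 p.1.2 p.2 :=
  (continuous_moveBack.measurable.comp (measurable_backState n)).prodMk
    (measurable_backState n).snd.snd

theorem measurable_backFlow :
    Measurable fun p : (ℝ × Phase) × (ℕ → Dir) => backFlow p.1.1 p.1.2 p.2 := by
  -- The number of steps depends on the point through a ceiling; it is treated as an independent
  -- countable variable and substituted afterwards.
  have h : Measurable fun q : ℕ × ((ℝ × Phase) × (ℕ → Dir)) =>
      stepFlow q.1 q.2.1.1 q.2.1.2 q.2.2 :=
    measurable_from_prod_countable_right fun n => measurable_stepFlow n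
  have hn : Measurable fun p : (ℝ × Phase) × (ℕ → Dir) => ⌈p.1.1 * ‖p.1.2.2‖⌉₊ :=
    Nat.measurable_ceil.comp (by fun_prop)
  simp_rw [backFlow_eq_stepFlow]
  exact Measurable.comp (f := fun p : (ℝ × Phase) × (ℕ → Dir) => (⌈p.1.1 * ‖p.1.2.2‖⌉₊, p)) h
    (hn.prodMk measurable_id)

/-! ### The law of the reflection directions -/

instance : IsProbabilityMeasure reflectionsLaw := by
  unfold reflectionsLaw; infer_instance

theorem ae_reflectionLaw : ∀ᵐ ω : Dir ∂reflectionLaw, (ω : Vel) 0 < 0 := by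
  have hm : Measurable fun ω : Dir => ENNReal.ofReal (c3 * negPart ω) :=
    (continuous_negPart.const_mul c3 |>.measurable).ennreal_ofReal
  rw [reflectionLaw, ae_withDensity_iff hm]
  refine Filter.Eventually.of_forall fun ω h => ?_
  by_contra h'
  exact h (by simp [negPart, max_eq_right (neg_nonpos.2 (not_lt.1 h'))])

theorem ae_reflectionsLaw : ∀ᵐ ω ∂reflectionsLaw, ∀ k, (ω k : Vel) 0 < 0 := by
  rw [ae_all_iff]
  intro k
  exact (measurePreserving_eval_infinitePi (fun _ : ℕ => reflectionLaw) k).quasiMeasurePreserving.ae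
    ae_reflectionLaw

/-- Prepend a direction to a sequence of directions. -/
def consDir (p : Dir × (ℕ → Dir)) : ℕ → Dir
  | 0 => p.1
  | k + 1 => p.2 k

theorem consDir_zero (p : Dir × (ℕ → Dir)) : consDir p 0 = p.1 := rfl

theorem consDir_succ (p : Dir × (ℕ → Dir)) (k : ℕ) : consDir p (k + 1) = p.2 k := rfl

theorem measurable_consDir : Measurable consDir := by
  refine measurable_pi_iff.2 fun k => ?_
  cases k with
  | zero => exact measurable_fst
  | succ k => exact (measurable_pi_apply k).comp measurable_snd

/-- An i.i.d. sequence is an independent first term followed by a copy of itself. It suffices to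
compare the two measures on cylinders. -/
theorem map_consDir : (reflectionLaw.prod reflectionsLaw).map consDir = reflectionsLaw := by
  classical
  refine Measure.eq_infinitePi _ fun s t ht => ?_
  obtain ⟨n, hn⟩ : ∃ n, s ⊆ Finset.range (n + 1) :=
    ⟨s.sup id, fun i hi => Finset.mem_range.2 (Nat.lt_succ_of_le (Finset.le_sup (f := id) hi))⟩
  -- Padding with `univ` makes the index set an initial segment, whose product splits into the
  -- factor at `0` and the shifted factors.
  set t' : ℕ → Set Dir := fun i => if i ∈ s then t i else univ with ht'
  have hm : ∀ i, MeasurableSet (t' i) := fun i => by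
    rw [ht']; dsimp only; split_ifs
    exacts [ht i, MeasurableSet.univ]
  have e1 : consDir ⁻¹' (Set.pi s t) = t' 0 ×ˢ Set.pi (Finset.range n) (fun i => t' (i + 1)) := by
    ext p
    simp only [mem_preimage, Set.mem_pi, Finset.mem_coe, mem_prod, Finset.mem_range]
    constructor
    · intro h
      refine ⟨?_, fun i _ => ?_⟩
      · rw [ht']; dsimp only; split_ifs with h0
        exacts [h 0 h0, mem_univ _]
      · rw [ht']; dsimp only; split_ifs with h0
        exacts [h _ h0, mem_univ _]
    · rintro ⟨h0, h1⟩ i hi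
      cases i with
      | zero => simpa [ht', hi, consDir_zero] using h0
      | succ i =>
        have := h1 i (by simpa using hn hi)
        simpa [ht', hi, consDir_succ] using this
  rw [Measure.map_apply measurable_consDir
    (MeasurableSet.pi s.countable_toSet fun i _ => ht i), e1, Measure.prod_prod, reflectionsLaw,
    Measure.infinitePi_pi _ fun i _ => hm (i + 1)]
  rw [mul_comm, ← Finset.prod_range_succ' (fun i => reflectionLaw (t' i)),
    ← Finset.prod_subset hn]
  · exact Finset.prod_congr rfl fun i hi => by simp [ht', hi]
  · intro i _ hi
    simp [ht', hi]

theorem integral_reflectionsLaw {F : (ℕ → Dir) → ℝ} (hF : Measurable F) {B : ℝ}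
    (hB : ∀ ω, |F ω| ≤ B) :
    ∫ ω, F ω ∂reflectionsLaw = ∫ a, ∫ ω, F (consDir (a, ω)) ∂reflectionsLaw ∂reflectionLaw := by
  have hi : Integrable (fun p => F (consDir p)) (reflectionLaw.prod reflectionsLaw) :=
    Integrable.of_bound (hF.comp measurable_consDir).aestronglyMeasurable B
      (Filter.Eventually.of_forall fun p => hB _)
  rw [← integral_prod _ hi, ← integral_map measurable_consDir.aemeasurable
    hF.aestronglyMeasurable, map_consDir]

/-! ### The transport operators -/

theorem norm_backFlow (t : ℝ) (z : Phase) (ω : ℕ → Dir) : ‖(backFlow t z ω).2‖ = ‖z.2‖ := by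
  rw [backFlow_eq_stepFlow, norm_stepFlow]

/-- The transport operator with at most `n` reflections. -/
def stepTransport (n : ℕ) (t : ℝ) (g : Phase → ℝ) (z : Phase) : ℝ :=
  ∫ ω, g (stepFlow n t z ω) ∂reflectionsLaw

theorem measurable_integral_flow {X Ω : Type*} [MeasurableSpace X] [MeasurableSpace Ω]
    (μ : Measure Ω) [SFinite μ] {F : (ℝ × Phase) × Ω → Phase} (hF : Measurable F)
    {g : X → Phase → ℝ} (hg : Measurable fun p : X × Phase => g p.1 p.2) {t : X → ℝ}
    (ht : Measurable t) {z : X → Phase} (hz : Measurable z) :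
    Measurable fun x => ∫ ω, g x (F ((t x, z x), ω)) ∂μ := by
  have h : Measurable fun p : X × Ω => g p.1 (F ((t p.1, z p.1), p.2)) :=
    hg.comp (measurable_fst.prodMk (hF.comp
      (((ht.comp measurable_fst).prodMk (hz.comp measurable_fst)).prodMk measurable_snd)))
  exact h.stronglyMeasurable.integral_prod_right.measurable

theorem measurable_transport {X : Type*} [MeasurableSpace X] {g : X → Phase → ℝ}
    (hg : Measurable fun p : X × Phase => g p.1 p.2) {t : X → ℝ} (ht : Measurable t)
    {z : X → Phase} (hz : Measurable z) : Measurable fun x => transport (t x) (g x) (z x) :=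
  measurable_integral_flow reflectionsLaw measurable_backFlow hg ht hz

theorem measurable_stepTransport (n : ℕ) {X : Type*} [MeasurableSpace X] {g : X → Phase → ℝ}
    (hg : Measurable fun p : X × Phase => g p.1 p.2) {t : X → ℝ} (ht : Measurable t)
    {z : X → Phase} (hz : Measurable z) : Measurable fun x => stepTransport n (t x) (g x) (z x) :=
  measurable_integral_flow reflectionsLaw (measurable_stepFlow n) hg ht hz

theorem abs_integral_le_of_forall {Ω : Type*} [MeasurableSpace Ω] {μ : Measure Ω}
    [IsProbabilityMeasure μ] {f : Ω → ℝ} {B : ℝ} (h : ∀ ω, |f ω| ≤ B) : |∫ ω, f ω ∂μ| ≤ B := by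
  have := norm_integral_le_of_norm_le_const (μ := μ) (f := f) (Filter.Eventually.of_forall h)
  simpa using this

theorem abs_stepTransport_le (n : ℕ) (t : ℝ) {g : Phase → ℝ} {z : Phase} {B : ℝ}
    (h : ∀ w : Phase, ‖w.2‖ = ‖z.2‖ → |g w| ≤ B) : |stepTransport n t g z| ≤ B :=
  abs_integral_le_of_forall fun ω => h _ (norm_stepFlow n t z ω)

theorem abs_transport_le (t : ℝ) {g : Phase → ℝ} {z : Phase} {B : ℝ}
    (h : ∀ w : Phase, ‖w.2‖ = ‖z.2‖ → |g w| ≤ B) : |transport t g z| ≤ B :=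
  abs_integral_le_of_forall fun ω => h _ (norm_backFlow t z ω)

theorem integrable_of_abs_le {Ω : Type*} [MeasurableSpace Ω] {μ : Measure Ω}
    [IsFiniteMeasure μ] {f : Ω → ℝ} {B : ℝ} (hf : Measurable f) (h : ∀ ω, |f ω| ≤ B) :
    Integrable f μ :=
  Integrable.of_bound hf.aestronglyMeasurable B (Filter.Eventually.of_forall h)

theorem integrable_backFlow (t : ℝ) {g : Phase → ℝ} (hg : Measurable g) {z : Phase} {B : ℝ}
    (h : ∀ w : Phase, ‖w.2‖ = ‖z.2‖ → |g w| ≤ B) :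
    Integrable (fun ω => g (backFlow t z ω)) reflectionsLaw := by
  have hm : Measurable fun ω => backFlow t z ω :=
    Measurable.of_uncurry_left (f := fun (x : ℝ × Phase) ω => backFlow x.1 x.2 ω)
      measurable_backFlow (x := (t, z))
  exact integrable_of_abs_le (hg.comp hm) fun ω => h _ (norm_backFlow t z ω)

theorem transport_sub (t : ℝ) {g h : Phase → ℝ} (hg : Measurable g) (hh : Measurable h)
    {z : Phase} {B : ℝ} (hgB : ∀ w : Phase, ‖w.2‖ = ‖z.2‖ → |g w| ≤ B)
    (hhB : ∀ w : Phase, ‖w.2‖ = ‖z.2‖ → |h w| ≤ B) :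
    transport t g z - transport t h z = transport t (fun w => g w - h w) z :=
  (integral_sub (integrable_backFlow t hg hgB) (integrable_backFlow t hh hhB)).symm

/-- Replaces the point-dependent number of reflections by a fixed `n`, which is what permits
induction on `n`. -/
theorem transport_eq_stepTransport {t : ℝ} {z : Phase} {n : ℕ} (hn : t * ‖z.2‖ ≤ n)
    (g : Phase → ℝ) : transport t g z = stepTransport n t g z :=
  integral_congr_ae (ae_reflectionsLaw.mono fun ω hω => by
    simp only [backFlow_eq_stepFlow_of_le hω hn])

theorem stepTransport_of_not_reflects {t : ℝ} {z : Phase} (h : ¬Reflects t z) (n : ℕ)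
    (g : Phase → ℝ) : stepTransport n t g z = g (moveBack t z.1 z.2, z.2) := by
  simp [stepTransport, stepFlow_of_not_reflects _ h]

theorem stepTransport_zero_reflections (t : ℝ) (g : Phase → ℝ) (z : Phase) :
    stepTransport 0 t g z = g (moveBack t z.1 z.2, z.2) := by
  simp [stepTransport, stepFlow_zero]

theorem not_reflects_of_le {t : ℝ} {z : Phase} (h : t ≤ backExit z.1 z.2) : ¬Reflects t z :=
  fun h' => (h'.2.trans_le h).false

theorem stepTransport_time_zero (n : ℕ) (g : Phase → ℝ) (z : Phase) :
    stepTransport n 0 g z = g z := by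
  rw [stepTransport_of_not_reflects (not_reflects_of_le (backExit_nonneg _ _)), moveBack_zero]

/-- Decomposition of the transport at the first reflection. -/
theorem stepTransport_succ_of_reflects {t : ℝ} {z : Phase} (h : Reflects t z) (n : ℕ)
    {g : Phase → ℝ} (hg : Measurable g) {B : ℝ} (hB : ∀ w, |g w| ≤ B) :
    stepTransport (n + 1) t g z =
      ∫ ω, stepTransport n (t - backExit z.1 z.2) g (reflectPt z ω) ∂reflectionLaw := by
  have hm : Measurable fun ω => g (stepFlow (n + 1) t z ω) :=
    hg.comp (Measurable.of_uncurry_left (f := fun (x : ℝ × Phase) ω => stepFlow (n + 1) x.1 x.2 ω)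
      (measurable_stepFlow (n + 1)) (x := (t, z)))
  rw [stepTransport, integral_reflectionsLaw hm fun ω => hB _]
  simp only [stepFlow_succ_of_reflects _ h, consDir_zero, consDir_succ]
  rfl

/-! ### The surface measure -/

/-- The cone over this great circle lies in a proper subspace, hence is Lebesgue null. -/
theorem surf_coord_eq_zero (i : Fin 3) : surf {ω : Dir | (ω : Vel) i = 0} = 0 := by
  have hm : MeasurableSet {ω : Dir | (ω : Vel) i = 0} :=
    (isClosed_eq (by fun_prop) continuous_const).measurableSet
  rw [surf, Measure.toSphere_apply' _ hm]
  refine mul_eq_zero_of_right _ ?_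
  let H : Submodule ℝ Vel :=
    { carrier := {v | v i = 0}
      add_mem' := fun {a b} ha hb => by simp_all
      zero_mem' := by simp
      smul_mem' := fun c x hx => by simp_all }
  have hH : H ≠ ⊤ := fun h => by
    have : EuclideanSpace.single i (1 : ℝ) ∈ H := h ▸ Submodule.mem_top
    have h1 : (EuclideanSpace.single i (1 : ℝ) : Vel) i = 0 := this
    simp at h1
  refine measure_mono_null ?_ (Measure.addHaar_submodule volume H hH)
  rintro _ ⟨r, _, _, ⟨ω, hω, rfl⟩, rfl⟩
  exact H.smul_mem r hω

theorem ae_surf_coord_ne_zero (i : Fin 3) : ∀ᵐ ω : Dir ∂surf, (ω : Vel) i ≠ 0 :=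
  measure_eq_zero_iff_ae_notMem.1 (surf_coord_eq_zero i)

theorem measurePreserving_neg_surf : MeasurePreserving (fun ω : Dir => -ω) surf surf := by
  refine ⟨continuous_neg.measurable, Measure.ext fun s hs => ?_⟩
  have hs' : MeasurableSet ((fun ω : Dir => -ω) ⁻¹' s) := continuous_neg.measurable hs
  rw [Measure.map_apply continuous_neg.measurable hs, surf, Measure.toSphere_apply' _ hs',
    Measure.toSphere_apply' _ hs]
  congr 1
  rw [← Measure.measure_preimage_neg]
  congr 1
  ext v
  simp only [Set.mem_preimage, Set.mem_smul, Set.mem_image]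
  constructor
  · rintro ⟨r, hr, _, ⟨ω, hω, rfl⟩, h⟩
    exact ⟨r, hr, _, ⟨-ω, by simpa using hω, rfl⟩, by simp [h]⟩
  · rintro ⟨r, hr, _, ⟨ω, hω, rfl⟩, h⟩
    exact ⟨r, hr, _, ⟨-ω, by simpa using hω, rfl⟩, by simp [← h]⟩

theorem c3_nonneg : 0 ≤ c3 := inv_nonneg.2 integral_negPart_pos.le

theorem integral_reflectionLaw (F : Dir → ℝ) :
    ∫ ω, F ω ∂reflectionLaw = ∫ ω, F ω * (c3 * negPart ω) ∂surf := by
  have hm : Measurable fun ω : Dir => ENNReal.ofReal (c3 * negPart ω) :=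
    (continuous_negPart.const_mul c3 |>.measurable).ennreal_ofReal
  rw [reflectionLaw, integral_withDensity_eq_integral_toReal_smul hm (by simp)]
  refine integral_congr_ae (Filter.Eventually.of_forall fun ω => ?_)
  simp only [smul_eq_mul]
  rw [ENNReal.toReal_ofReal (mul_nonneg c3_nonneg (negPart_nonneg _)), mul_comm]

/-- The compatibility condition puts the sign `Γ` in the density, the dynamics puts it in the
velocity. The two agree after `ω ↦ Γ ω`, which at the wall `Γ = -1` is the antipodal map and
preserves `surf`. -/
theorem integral_reflectPt {f₀ : Phase → ℝ} (hd : DiffuseCondition f₀) {z : Phase}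
    (h : z.2 0 ≠ 0) : ∫ ω, f₀ (reflectPt z ω) ∂reflectionLaw = f₀ (hitPoint z, z.2) := by
  rw [hd _ (hitPoint_mem_outgoing h), integral_reflectionLaw]
  unfold reflectPt
  rcases (abs_eq (zero_le_one' ℝ)).1 (abs_bdrySign (hitPoint z)) with hs | hs
  · simp [hs]
  · rw [← measurePreserving_neg_surf.integral_comp (Homeomorph.neg Dir).measurableEmbedding]
    simp [hs]

/-! ### Continuity of a single flight -/

theorem continuousAt_backExit {z : Phase} (h : z.2 0 ≠ 0) :
    ContinuousAt (fun z : Phase => backExit z.1 z.2) z := by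
  rcases lt_or_gt_of_ne h with h' | h'
  · have e : (fun z : Phase => backExit z.1 z.2) =ᶠ[nhds z]
        fun z => (1 - (z.1.1 : ℝ)) / (-(z.2 0)) := by
      filter_upwards [(isOpen_lt (by fun_prop : Continuous fun z : Phase => z.2 0)
        continuous_const).mem_nhds h'] with w hw
      exact if_neg (not_lt.2 (le_of_lt hw))
    have hc : ContinuousAt (fun z : Phase => (1 - (z.1.1 : ℝ)) / (-(z.2 0))) z :=
      ContinuousAt.div (by fun_prop) (by fun_prop) (neg_ne_zero.2 h)
    exact hc.congr e.symm
  · have e : (fun z : Phase => backExit z.1 z.2) =ᶠ[nhds z] fun z => (z.1.1 : ℝ) / z.2 0 := by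
      filter_upwards [(isOpen_lt continuous_const
        (by fun_prop : Continuous fun z : Phase => z.2 0)).mem_nhds h'] with w hw
      exact if_pos hw
    have hc : ContinuousAt (fun z : Phase => (z.1.1 : ℝ) / z.2 0) z :=
      ContinuousAt.div (by fun_prop) (by fun_prop) h
    exact hc.congr e.symm

theorem eventually_apply_zero_ne {z : Phase} (h : z.2 0 ≠ 0) : ∀ᶠ w : Phase in nhds z, w.2 0 ≠ 0 :=
  (isOpen_ne_fun (by fun_prop : Continuous fun z : Phase => z.2 0) continuous_const).mem_nhds h

theorem continuousAt_hitPoint {z : Phase} (h : z.2 0 ≠ 0) : ContinuousAt hitPoint z :=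
  continuous_moveBack.continuousAt.comp ((continuousAt_backExit h).prodMk continuousAt_id)

theorem continuousAt_reflectPt {z : Phase} (h : z.2 0 ≠ 0) (ω : Dir) :
    ContinuousAt (fun w => reflectPt w ω) z := by
  -- The wall that is hit depends only on the sign of the normal velocity, so `bdrySign` is locally
  -- constant along `hitPoint`.
  have hb : ContinuousAt (fun w : Phase => bdrySign (hitPoint w)) z := by
    rcases lt_or_gt_of_ne h with h' | h'
    · have e : (fun w : Phase => bdrySign (hitPoint w)) =ᶠ[nhds z] fun _ => -1 := by
        filter_upwards [(isOpen_lt (by fun_prop : Continuous fun z : Phase => z.2 0)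
          continuous_const).mem_nhds h'] with w hw
        rw [bdrySign_hitPoint (ne_of_lt hw), if_neg (not_lt.2 (le_of_lt hw))]
      exact continuousAt_const.congr e.symm
    · have e : (fun w : Phase => bdrySign (hitPoint w)) =ᶠ[nhds z] fun _ => 1 := by
        filter_upwards [(isOpen_lt continuous_const
          (by fun_prop : Continuous fun z : Phase => z.2 0)).mem_nhds h'] with w hw
        rw [bdrySign_hitPoint (ne_of_gt hw), if_pos hw]
      exact continuousAt_const.congr e.symm
  unfold reflectPt
  exact (continuousAt_hitPoint h).prodMk
    ((ContinuousAt.mul (by fun_prop) hb).smul continuousAt_const)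

/-- From an interior point with tangential velocity, nearby particles have a normal speed too small
to cover the distance to a wall within time `T`. -/
theorem eventually_not_reflects (T : ℝ) {z : Phase} (h0 : z.2 0 = 0) (hz : ¬OnBoundary z.1) :
    ∀ᶠ w : Phase in nhds z, ∀ t ≤ T, ¬Reflects t w := by
  have hx0 : 0 < (z.1.1 : ℝ) := lt_of_le_of_ne z.1.1.2.1 fun h => hz (Or.inl h.symm)
  have hx1 : (z.1.1 : ℝ) < 1 := lt_of_le_of_ne z.1.1.2.2 fun h => hz (Or.inr h)
  have h1 : ∀ᶠ w : Phase in nhds z, |w.2 0| * T < (w.1.1 : ℝ) :=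
    (isOpen_lt (f := fun w : Phase => |w.2 0| * T) (g := fun w : Phase => (w.1.1 : ℝ))
      (by fun_prop) (by fun_prop)).mem_nhds (by simpa [h0] using hx0)
  have h2 : ∀ᶠ w : Phase in nhds z, |w.2 0| * T < 1 - (w.1.1 : ℝ) :=
    (isOpen_lt (f := fun w : Phase => |w.2 0| * T) (g := fun w : Phase => 1 - (w.1.1 : ℝ))
      (by fun_prop) (by fun_prop)).mem_nhds (by simpa [h0] using hx1)
  filter_upwards [h1, h2] with w hw1 hw2 t ht hr
  have hlt := hr.2.trans_le ht
  unfold backExit at hlt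
  split_ifs at hlt with h
  · rw [div_lt_iff₀ h] at hlt
    rw [abs_of_pos h] at hw1
    linarith
  · have h' : w.2 0 < 0 := lt_of_le_of_ne (not_lt.1 h) hr.1
    rw [div_lt_iff₀ (neg_pos.2 h')] at hlt
    rw [abs_of_neg h'] at hw2
    linarith

/-! ### Continuity of the transport off the grazing set -/

/-- Times in `[0,T]` and phase points off the grazing set. -/
def domain (T : ℝ) : Set (ℝ × Phase) := Icc 0 T ×ˢ grazingᶜ

/-- Contribution of a free flight of variable duration `μ`. Rescaling to the unit interval puts all
dependence on `p` into the integrand and the prefactor, so dominated convergence applies. -/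
theorem continuousWithinAt_free {T B : ℝ} {q : ℝ → Phase → ℝ}
    (hm : Measurable fun p : ℝ × Phase => q p.1 p.2) (hB : ∀ t z, |q t z| ≤ B)
    (hc : ContinuousOn (fun p : ℝ × Phase => q p.1 p.2) (domain T)) {p₀ : ℝ × Phase}
    (hp₀ : p₀ ∈ domain T) {μ : ℝ × Phase → ℝ} (hμ : ContinuousWithinAt μ (domain T) p₀)
    (h0 : ∀ p ∈ domain T, 0 ≤ μ p) (h1 : ∀ p ∈ domain T, μ p ≤ p.1) :
    ContinuousWithinAt (fun p => μ p *
      ∫ θ in (0 : ℝ)..1, q (p.1 - μ p * θ) (moveBack (μ p * θ) p.2.1 p.2.2, p.2.2))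
      (domain T) p₀ := by
  refine hμ.mul (intervalIntegral.continuousWithinAt_of_dominated_interval (bound := fun _ => B)
    (Filter.Eventually.of_forall fun p => ?_)
    (Filter.Eventually.of_forall fun p => Filter.Eventually.of_forall fun θ _ => hB _ _)
    intervalIntegrable_const (Filter.Eventually.of_forall fun θ hθ => ?_))
  · refine Measurable.aestronglyMeasurable (hm.comp (Measurable.prodMk (by fun_prop)
      (Measurable.prodMk ?_ measurable_const)))
    exact (continuous_moveBack.comp
      (by fun_prop : Continuous fun θ : ℝ => (μ p * θ, p.2.1, p.2.2))).measurable
  · rw [uIoc_of_le zero_le_one] at hθ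
    have hG : ContinuousWithinAt (fun p : ℝ × Phase =>
        (p.1 - μ p * θ, ((moveBack (μ p * θ) p.2.1 p.2.2, p.2.2) : Phase))) (domain T) p₀ := by
      have hμθ : ContinuousWithinAt (fun p => μ p * θ) (domain T) p₀ := hμ.mul_const θ
      have h2 : ContinuousWithinAt (fun p : ℝ × Phase => p.2) (domain T) p₀ :=
        continuous_snd.continuousWithinAt
      exact (continuous_fst.continuousWithinAt.sub hμθ).prodMk
        ((continuous_moveBack.continuousAt.comp_continuousWithinAt (hμθ.prodMk h2)).prodMk h2.snd)
    refine ContinuousWithinAt.comp (t := domain T) (hc _ ?_) hG ?_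
    all_goals
      try intro p hp
    · have := h0 _ hp₀
      have := h1 _ hp₀
      refine ⟨⟨?_, ?_⟩, moveBack_mem_compl_grazing _ hp₀.2⟩
      · show 0 ≤ p₀.1 - μ p₀ * θ
        nlinarith [hθ.1, hθ.2]
      · show p₀.1 - μ p₀ * θ ≤ T
        nlinarith [hθ.1, hθ.2, hp₀.1.2]
    · have := h0 _ hp
      have := h1 _ hp
      refine ⟨⟨?_, ?_⟩, moveBack_mem_compl_grazing _ hp.2⟩
      · show 0 ≤ p.1 - μ p * θ
        nlinarith [hθ.1, hθ.2]
      · show p.1 - μ p * θ ≤ T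
        nlinarith [hθ.1, hθ.2, hp.1.2]

/-- Dominated convergence: for almost every direction the reflected point depends continuously on
`p` and avoids the grazing set, where alone `W` may fail to be continuous. -/
theorem continuousWithinAt_integral_reflectPt {T B : ℝ} {W : ℝ → Phase → ℝ}
    (hm : Measurable fun p : ℝ × Phase => W p.1 p.2) (hB : ∀ t ∈ Icc 0 T, ∀ z, |W t z| ≤ B)
    (hc : ContinuousOn (fun p : ℝ × Phase => W p.1 p.2) (domain T)) {p₀ : ℝ × Phase}
    (hp₀ : p₀ ∈ domain T) (hv : p₀.2.2 0 ≠ 0) {τ : ℝ × Phase → ℝ}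
    (hτ : ContinuousWithinAt τ (domain T) p₀) (h01 : ∀ p ∈ domain T, τ p ∈ Icc 0 T) :
    ContinuousWithinAt (fun p => ∫ ω, W (τ p) (reflectPt p.2 ω) ∂reflectionLaw)
      (domain T) p₀ := by
  have hev : ∀ᶠ p in nhdsWithin p₀ (domain T), p.2.2 0 ≠ 0 :=
    (continuous_snd.tendsto p₀ |>.eventually (eventually_apply_zero_ne hv)).filter_mono
      nhdsWithin_le_nhds
  refine continuousWithinAt_of_dominated (bound := fun _ => B)
    (Filter.Eventually.of_forall fun p => ?_) ?_ (integrable_const _) ?_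
  · exact (hm.comp (measurable_const.prodMk (measurable_reflectPt.comp
      measurable_prodMk_left))).aestronglyMeasurable
  · filter_upwards [self_mem_nhdsWithin] with p hp
    exact Filter.Eventually.of_forall fun ω => hB _ (h01 p hp) _
  · filter_upwards [ae_reflectionLaw] with ω hω
    have hG : ContinuousWithinAt (fun p : ℝ × Phase => (τ p, reflectPt p.2 ω)) (domain T) p₀ :=
      hτ.prodMk ((ContinuousAt.comp (f := Prod.snd) (x := p₀) (continuousAt_reflectPt hv ω)
        continuous_snd.continuousAt).continuousWithinAt)
    refine Filter.Tendsto.comp (hc (τ p₀, reflectPt p₀.2 ω) ⟨h01 _ hp₀,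
      mem_compl_grazing_of_ne (reflectPt_apply_zero_ne hv hω)⟩)
      (tendsto_nhdsWithin_iff.2 ⟨hG, ?_⟩)
    filter_upwards [hev, self_mem_nhdsWithin] with p hp hp'
    exact ⟨h01 _ hp', mem_compl_grazing_of_ne (reflectPt_apply_zero_ne hp hω)⟩

/-- Near zero velocity the exit time has no useful limit, but none is needed: the flow displaces the
position by at most `T * ‖v‖` and keeps the speed, however many reflections occur. -/
theorem continuousWithinAt_stepTransport_of_velocity_zero {T B : ℝ} {q : ℝ → Phase → ℝ}
    (hm : Measurable fun p : ℝ × Phase => q p.1 p.2) (hB : ∀ t z, |q t z| ≤ B)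
    (hc : ContinuousOn (fun p : ℝ × Phase => q p.1 p.2) (domain T)) {p₀ : ℝ × Phase}
    (hp₀ : p₀ ∈ domain T) (hv : p₀.2.2 = 0) {a b : ℝ × Phase → ℝ}
    (hb : ContinuousWithinAt b (domain T) p₀) (ha : ∀ p ∈ domain T, a p ∈ Icc 0 T)
    (hb' : ∀ p ∈ domain T, b p ∈ Icc 0 T) (n : ℕ) :
    ContinuousWithinAt (fun p => stepTransport n (a p) (q (b p)) p.2) (domain T) p₀ := by
  have hT : 0 ≤ T := hp₀.1.1.trans hp₀.1.2
  refine continuousWithinAt_of_dominated (bound := fun _ => B)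
    (Filter.Eventually.of_forall fun p => ?_)
    (Filter.Eventually.of_forall fun p => Filter.Eventually.of_forall fun ω => hB _ _)
    (integrable_const _) ?_
  · exact (hm.comp (measurable_const.prodMk (Measurable.of_uncurry_left
      (f := fun (x : ℝ × Phase) ω => stepFlow n x.1 x.2 ω) (measurable_stepFlow n)
      (x := (a p, p.2))))).aestronglyMeasurable
  · filter_upwards [ae_reflectionsLaw] with ω hω
    have hs : stepFlow n (a p₀) p₀.2 ω = p₀.2 := by
      refine Prod.ext ?_ ?_
      · have := dist_stepFlow_le n (ha p₀ hp₀).1 p₀.2 ω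
        rw [hv, norm_zero, mul_zero] at this
        exact dist_le_zero.1 this
      · have := norm_stepFlow n (a p₀) p₀.2 ω
        rw [hv, norm_zero, norm_eq_zero] at this
        rw [this, hv]
    have hnorm : Filter.Tendsto (fun p : ℝ × Phase => ‖p.2.2‖) (nhdsWithin p₀ (domain T))
        (nhds 0) := by
      have : ContinuousWithinAt (fun p : ℝ × Phase => ‖p.2.2‖) (domain T) p₀ := by fun_prop
      simpa [ContinuousWithinAt, hv] using this
    have h1 : Filter.Tendsto (fun p : ℝ × Phase => (stepFlow n (a p) p.2 ω).1)
        (nhdsWithin p₀ (domain T)) (nhds p₀.2.1) := by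
      have hd : Filter.Tendsto (fun p : ℝ × Phase => T * ‖p.2.2‖ + dist p.2.1 p₀.2.1)
          (nhdsWithin p₀ (domain T)) (nhds 0) := by
        have h2 : ContinuousWithinAt (fun p : ℝ × Phase => dist p.2.1 p₀.2.1) (domain T) p₀ := by
          fun_prop
        simpa [ContinuousWithinAt] using (hnorm.const_mul T).add h2
      rw [tendsto_iff_dist_tendsto_zero]
      refine squeeze_zero' (Filter.Eventually.of_forall fun _ => dist_nonneg) ?_ hd
      filter_upwards [self_mem_nhdsWithin] with p hp
      refine (dist_triangle _ p.2.1 _).trans (add_le_add_left ?_ _)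
      exact (dist_stepFlow_le n (ha p hp).1 p.2 ω).trans
        (mul_le_mul_of_nonneg_right (ha p hp).2 (norm_nonneg _))
    have h2 : Filter.Tendsto (fun p : ℝ × Phase => (stepFlow n (a p) p.2 ω).2)
        (nhdsWithin p₀ (domain T)) (nhds p₀.2.2) := by
      rw [hv, tendsto_zero_iff_norm_tendsto_zero]
      simpa only [norm_stepFlow] using hnorm
    have h3 : ContinuousWithinAt (fun p : ℝ × Phase => q p.1 p.2) (domain T) (b p₀, p₀.2) :=
      hc _ ⟨hb' _ hp₀, hp₀.2⟩
    have h4 : Filter.Tendsto (fun p : ℝ × Phase => (b p, stepFlow n (a p) p.2 ω))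
        (nhdsWithin p₀ (domain T)) (nhdsWithin (b p₀, p₀.2) (domain T)) := by
      refine tendsto_nhdsWithin_iff.2 ⟨hb.prodMk_nhds (h1.prodMk_nhds h2), ?_⟩
      filter_upwards [self_mem_nhdsWithin] with p hp
      exact ⟨hb' p hp, stepFlow_mem_compl_grazing n _ hω hp.2⟩
    have := h3.tendsto.comp h4
    simpa [ContinuousWithinAt, hs, Function.comp_def] using this

/-- The time of the first reflection, or the time to travel if there is none. -/
def flightTime (p : ℝ × Phase) : ℝ := min p.1 (backExit p.2.1 p.2.2)

theorem flightTime_nonneg {p : ℝ × Phase} (h : 0 ≤ p.1) : 0 ≤ flightTime p :=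
  le_min h (backExit_nonneg _ _)

theorem flightTime_le (p : ℝ × Phase) : flightTime p ≤ p.1 := min_le_left _ _

theorem continuousAt_flightTime {p : ℝ × Phase} (h : p.2.2 0 ≠ 0) : ContinuousAt flightTime p :=
  continuous_fst.continuousAt.min
    (ContinuousAt.comp (f := Prod.snd) (x := p) (continuousAt_backExit h)
      continuous_snd.continuousAt)

/-- The transport of a datum with the diffuse reflection condition, decomposed without cases
at the first reflection. -/
theorem stepTransport_succ_of_diffuse {f₀ : Phase → ℝ} (hd : DiffuseCondition f₀)
    (hm : Measurable f₀) {B : ℝ} (hB : ∀ z, |f₀ z| ≤ B) {p : ℝ × Phase} (hv : p.2.2 0 ≠ 0)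
    (n : ℕ) : stepTransport (n + 1) p.1 f₀ p.2 =
      (∫ ω, stepTransport n (p.1 - flightTime p) f₀ (reflectPt p.2 ω) ∂reflectionLaw) -
      (∫ ω, f₀ (reflectPt p.2 ω) ∂reflectionLaw) +
      f₀ (moveBack (flightTime p) p.2.1 p.2.2, p.2.2) := by
  -- If the particle reflects, the last two terms cancel by compatibility. If not, the transport
  -- over the remaining time zero is the identity and the first two cancel.
  rcases lt_or_ge (backExit p.2.1 p.2.2) p.1 with h | h
  · have e : flightTime p = backExit p.2.1 p.2.2 := min_eq_right h.le
    rw [stepTransport_succ_of_reflects ⟨hv, h⟩ n hm hB, integral_reflectPt hd hv, e]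
    unfold hitPoint
    ring
  · have e : flightTime p = p.1 := min_eq_left h
    rw [stepTransport_of_not_reflects (not_reflects_of_le h), e, sub_self]
    simp only [stepTransport_time_zero]
    ring

theorem not_onBoundary_of_mem {z : Phase} (hz : z ∈ grazingᶜ) (h0 : z.2 0 = 0) (hv : z.2 ≠ 0) :
    ¬OnBoundary z.1 := fun h => hz ⟨h, h0, hv⟩

/-- Off the grazing set there are three kinds of points: zero velocity, interior points with
tangential velocity (locally free flight), and nonzero normal velocity. In the last case each term
of `stepTransport_succ_of_diffuse` is continuous, because `flightTime` is. -/
theorem continuousOn_stepTransport {T B : ℝ} {f₀ : Phase → ℝ} (hf : Continuous f₀)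
    (hd : DiffuseCondition f₀) (hB : ∀ z, |f₀ z| ≤ B) (n : ℕ) :
    ContinuousOn (fun p : ℝ × Phase => stepTransport n p.1 f₀ p.2) (domain T) := by
  have hfree : Continuous fun p : ℝ × Phase => f₀ (moveBack p.1 p.2.1 p.2.2, p.2.2) :=
    hf.comp (continuous_moveBack.prodMk (by fun_prop))
  induction n with
  | zero =>
    simp only [stepTransport_zero_reflections]
    exact hfree.continuousOn
  | succ n ih =>
    intro p₀ hp₀
    by_cases hv : p₀.2.2 0 = 0
    · by_cases hv' : p₀.2.2 = 0
      · exact continuousWithinAt_stepTransport_of_velocity_zero (q := fun _ => f₀)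
          (hf.measurable.comp measurable_snd) (fun _ => hB) (hf.comp continuous_snd).continuousOn
          hp₀ hv' (b := Prod.fst) continuous_fst.continuousWithinAt (fun p hp => hp.1)
          (fun p hp => hp.1) (n + 1)
      · refine hfree.continuousWithinAt.congr_of_eventuallyEq_of_mem ?_ hp₀
        filter_upwards [(continuous_snd.tendsto p₀ |>.eventually (eventually_not_reflects T hv
          (not_onBoundary_of_mem hp₀.2 hv hv'))).filter_mono nhdsWithin_le_nhds,
          self_mem_nhdsWithin] with p hp hp'
        exact stepTransport_of_not_reflects (hp _ hp'.1.2) _ _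
    · have hfl : ContinuousWithinAt flightTime (domain T) p₀ :=
        (continuousAt_flightTime hv).continuousWithinAt
      have h1 : ContinuousWithinAt (fun p : ℝ × Phase =>
          ∫ ω, stepTransport n (p.1 - flightTime p) f₀ (reflectPt p.2 ω) ∂reflectionLaw)
          (domain T) p₀ :=
        continuousWithinAt_integral_reflectPt (W := fun t z => stepTransport n t f₀ z)
          (τ := fun p => p.1 - flightTime p)
          (measurable_stepTransport n (g := fun _ => f₀) (hf.measurable.comp measurable_snd)
            measurable_fst measurable_snd)
          (fun t _ z => abs_stepTransport_le n t fun w _ => hB w) ih hp₀ hv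
          (continuous_fst.continuousWithinAt.sub hfl)
          fun p hp => ⟨sub_nonneg.2 (flightTime_le p),
            (sub_le_self _ (flightTime_nonneg hp.1.1)).trans hp.1.2⟩
      have h2 : ContinuousWithinAt (fun p : ℝ × Phase =>
          ∫ ω, f₀ (reflectPt p.2 ω) ∂reflectionLaw) (domain T) p₀ :=
        continuousWithinAt_integral_reflectPt (W := fun _ z => f₀ z) (τ := Prod.fst)
          (hf.measurable.comp measurable_snd) (fun t _ z => hB z)
          (hf.comp continuous_snd).continuousOn hp₀ hv continuous_fst.continuousWithinAt
          fun p hp => hp.1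
      have h3 : ContinuousWithinAt (fun p : ℝ × Phase =>
          f₀ (moveBack (flightTime p) p.2.1 p.2.2, p.2.2)) (domain T) p₀ :=
        hfree.continuousAt.comp_continuousWithinAt (f := fun p : ℝ × Phase => (flightTime p, p.2))
          (hfl.prodMk continuous_snd.continuousWithinAt)
      refine ((h1.sub h2).add h3).congr_of_eventuallyEq_of_mem ?_ hp₀
      filter_upwards [(continuous_snd.tendsto p₀ |>.eventually
        (eventually_apply_zero_ne hv)).filter_mono nhdsWithin_le_nhds] with p hp
      exact stepTransport_succ_of_diffuse hd hf.measurable hB hp n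

/-! ### Continuity of the Duhamel term off the grazing set -/

/-- The Duhamel term with at most `n` reflections. -/
def stepDuhamel (n : ℕ) (t : ℝ) (q : ℝ → Phase → ℝ) (z : Phase) : ℝ :=
  ∫ r in (0 : ℝ)..t, stepTransport n r (q (t - r)) z

/-- The Duhamel term of the mild formulation. -/
def duhamel (t : ℝ) (q : ℝ → Phase → ℝ) (z : Phase) : ℝ :=
  ∫ τ in (0 : ℝ)..t, transport (t - τ) (q τ) z

theorem measurable_integral_unit {X : Type*} [MeasurableSpace X] {F : X × ℝ → ℝ}
    (hF : Measurable F) : Measurable fun x => ∫ θ in (0 : ℝ)..1, F (x, θ) := by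
  simp only [intervalIntegral.integral_of_le zero_le_one]
  exact hF.stronglyMeasurable.integral_prod_right'.measurable

theorem integral_eq_mul_integral_unit (f : ℝ → ℝ) (t : ℝ) :
    ∫ r in (0 : ℝ)..t, f r = t * ∫ θ in (0 : ℝ)..1, f (t * θ) := by
  have := intervalIntegral.smul_integral_comp_mul_left (a := 0) (b := 1) f t
  rw [mul_zero, mul_one] at this
  exact this.symm

theorem stepDuhamel_eq (n : ℕ) (t : ℝ) (q : ℝ → Phase → ℝ) (z : Phase) :
    stepDuhamel n t q z = t * ∫ θ in (0 : ℝ)..1, stepTransport n (t * θ) (q (t - t * θ)) z :=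
  integral_eq_mul_integral_unit (fun r => stepTransport n r (q (t - r)) z) t

theorem measurable_stepDuhamel (n : ℕ) {q : ℝ → Phase → ℝ}
    (hm : Measurable fun p : ℝ × Phase => q p.1 p.2) :
    Measurable fun p : ℝ × Phase => stepDuhamel n p.1 q p.2 := by
  simp only [stepDuhamel_eq]
  refine measurable_fst.mul (measurable_integral_unit
    (F := fun x : (ℝ × Phase) × ℝ => stepTransport n (x.1.1 * x.2) (q (x.1.1 - x.1.1 * x.2)) x.1.2)
    (measurable_stepTransport n (g := fun x : (ℝ × Phase) × ℝ => q (x.1.1 - x.1.1 * x.2)) ?_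
      (by fun_prop) (by fun_prop)))
  exact hm.comp (Measurable.prodMk (by fun_prop) measurable_snd)

theorem measurable_duhamel {q : ℝ → Phase → ℝ} (hm : Measurable fun p : ℝ × Phase => q p.1 p.2) :
    Measurable fun p : ℝ × Phase => duhamel p.1 q p.2 := by
  have e : ∀ p : ℝ × Phase, duhamel p.1 q p.2 =
      p.1 * ∫ θ in (0 : ℝ)..1, transport (p.1 - p.1 * θ) (q (p.1 * θ)) p.2 := fun p =>
    integral_eq_mul_integral_unit (fun τ => transport (p.1 - τ) (q τ) p.2) p.1
  simp only [e]
  refine measurable_fst.mul (measurable_integral_unit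
    (F := fun x : (ℝ × Phase) × ℝ => transport (x.1.1 - x.1.1 * x.2) (q (x.1.1 * x.2)) x.1.2)
    (measurable_transport (g := fun x : (ℝ × Phase) × ℝ => q (x.1.1 * x.2)) ?_
      (by fun_prop) (by fun_prop)))
  exact hm.comp (Measurable.prodMk (by fun_prop) measurable_snd)

theorem duhamel_eq_stepDuhamel {t : ℝ} (ht : 0 ≤ t) {z : Phase} {n : ℕ} (hn : t * ‖z.2‖ ≤ n)
    (q : ℝ → Phase → ℝ) : duhamel t q z = stepDuhamel n t q z := by
  have h := intervalIntegral.integral_comp_sub_left (a := 0) (b := t)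
    (fun τ => transport (t - τ) (q τ) z) t
  rw [sub_self, sub_zero] at h
  rw [duhamel, ← h, stepDuhamel]
  refine intervalIntegral.integral_congr fun r hr => ?_
  rw [uIcc_of_le ht] at hr
  simp only [sub_sub_cancel]
  exact transport_eq_stepTransport
    ((mul_le_mul_of_nonneg_right hr.2 (norm_nonneg _)).trans hn) _

theorem abs_stepDuhamel_le (n : ℕ) {T B : ℝ} {q : ℝ → Phase → ℝ} (hB : ∀ t z, |q t z| ≤ B)
    {t : ℝ} (ht : t ∈ Icc 0 T) (z : Phase) : |stepDuhamel n t q z| ≤ B * T := by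
  have h := intervalIntegral.norm_integral_le_of_norm_le_const (a := 0) (b := t) (C := B)
    (f := fun r => stepTransport n r (q (t - r)) z)
    fun r _ => abs_stepTransport_le n r fun w _ => hB _ w
  rw [sub_zero, abs_of_nonneg ht.1] at h
  exact h.trans (mul_le_mul_of_nonneg_left ht.2 ((abs_nonneg _).trans (hB 0 z)))

/-- Decomposition of the Duhamel term at the first reflection. -/
theorem stepDuhamel_succ {B : ℝ} {q : ℝ → Phase → ℝ}
    (hm : Measurable fun p : ℝ × Phase => q p.1 p.2) (hB : ∀ t z, |q t z| ≤ B) {p : ℝ × Phase}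
    (hp : 0 ≤ p.1) (hv : p.2.2 0 ≠ 0) (n : ℕ) :
    stepDuhamel (n + 1) p.1 q p.2 = flightTime p *
        (∫ θ in (0 : ℝ)..1, q (p.1 - flightTime p * θ)
          (moveBack (flightTime p * θ) p.2.1 p.2.2, p.2.2)) +
      ∫ ω, stepDuhamel n (p.1 - flightTime p) q (reflectPt p.2 ω) ∂reflectionLaw := by
  obtain ⟨t, z⟩ := p
  simp only at hp hv ⊢
  have hmS : Measurable fun r => stepTransport (n + 1) r (q (t - r)) z :=
    measurable_stepTransport (n + 1) (g := fun r => q (t - r))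
      (hm.comp (Measurable.prodMk (by fun_prop) measurable_snd)) measurable_id measurable_const
  have hint : ∀ a b, IntervalIntegrable (fun r => stepTransport (n + 1) r (q (t - r)) z)
      volume a b := fun a b =>
    (intervalIntegrable_const (c := B)).mono_fun hmS.aestronglyMeasurable
      (Filter.Eventually.of_forall fun r =>
        (abs_stepTransport_le (n + 1) r fun w _ => hB _ w).trans (le_abs_self B))
  have hf0 : 0 ≤ flightTime (t, z) := flightTime_nonneg (p := (t, z)) hp
  rw [stepDuhamel, ← intervalIntegral.integral_add_adjacent_intervals
    (hint 0 (flightTime (t, z))) (hint _ t)]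
  congr 1
  · rw [← integral_eq_mul_integral_unit (fun r => q (t - r) (moveBack r z.1 z.2, z.2))]
    refine intervalIntegral.integral_congr fun r hr => ?_
    rw [uIcc_of_le hf0] at hr
    exact stepTransport_of_not_reflects
      (not_reflects_of_le (hr.2.trans (min_le_right _ _))) _ _
  -- After the exit time the first direction is averaged out; Fubini and a time shift by the exit
  -- time give a Duhamel term started at the reflected point. Without a reflection both sides
  -- vanish.
  · rcases lt_or_ge (backExit z.1 z.2) t with h | h
    · have e : flightTime (t, z) = backExit z.1 z.2 := min_eq_right h.le
      rw [e]
      have h1 : ∫ r in backExit z.1 z.2..t, stepTransport (n + 1) r (q (t - r)) z =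
          ∫ r in backExit z.1 z.2..t, ∫ ω, stepTransport n (r - backExit z.1 z.2) (q (t - r))
            (reflectPt z ω) ∂reflectionLaw := by
        refine intervalIntegral.integral_congr_ae (Filter.Eventually.of_forall fun r hr => ?_)
        rw [uIoc_of_le h.le] at hr
        exact stepTransport_succ_of_reflects ⟨hv, hr.1⟩ n (hm.comp measurable_prodMk_left)
          fun w => hB _ w
      rw [h1, intervalIntegral_integral_swap]
      · refine integral_congr_ae (Filter.Eventually.of_forall fun ω => ?_)
        have h2 := intervalIntegral.integral_comp_sub_right (a := backExit z.1 z.2) (b := t)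
          (fun r => stepTransport n r (q (t - backExit z.1 z.2 - r)) (reflectPt z ω))
          (backExit z.1 z.2)
        simp only [sub_self, sub_sub_sub_cancel_right] at h2
        exact h2
      · have : IsFiniteMeasure (volume.restrict (uIoc (backExit z.1 z.2) t)) := by
          rw [uIoc_of_le h.le]; infer_instance
        refine Integrable.of_bound (Measurable.aestronglyMeasurable ?_) B
          (Filter.Eventually.of_forall fun x => abs_stepTransport_le n _ fun w _ => hB _ w)
        refine measurable_stepTransport n (X := ℝ × Dir) (t := fun x => x.1 - backExit z.1 z.2)
          (g := fun x => q (t - x.1)) (z := fun x => reflectPt z x.2) ?_ (by fun_prop) ?_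
        · exact hm.comp (Measurable.prodMk (by fun_prop) measurable_snd)
        · exact measurable_reflectPt.comp (measurable_const.prodMk measurable_snd)
    · have e : flightTime (t, z) = t := min_eq_left h
      simp [e, stepDuhamel]

/-- The same three cases as for the transport, but with no compatibility condition on `q`: a jump at
the exit time concerns one instant of the time integral, and `flightTime` enters `stepDuhamel_succ`
only continuously. -/
theorem continuousOn_stepDuhamel {T B : ℝ} {q : ℝ → Phase → ℝ}
    (hm : Measurable fun p : ℝ × Phase => q p.1 p.2) (hB : ∀ t z, |q t z| ≤ B)
    (hc : ContinuousOn (fun p : ℝ × Phase => q p.1 p.2) (domain T)) (n : ℕ) :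
    ContinuousOn (fun p : ℝ × Phase => stepDuhamel n p.1 q p.2) (domain T) := by
  have hfree : ∀ p₀ ∈ domain T, ContinuousWithinAt (fun p : ℝ × Phase => p.1 *
      ∫ θ in (0 : ℝ)..1, q (p.1 - p.1 * θ) (moveBack (p.1 * θ) p.2.1 p.2.2, p.2.2))
      (domain T) p₀ := fun p₀ hp₀ =>
    continuousWithinAt_free hm hB hc hp₀ continuous_fst.continuousWithinAt (fun p hp => hp.1.1)
      fun p _ => le_rfl
  induction n with
  | zero =>
    intro p₀ hp₀
    simpa only [stepDuhamel_eq, stepTransport_zero_reflections] using hfree p₀ hp₀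
  | succ n ih =>
    intro p₀ hp₀
    by_cases hv : p₀.2.2 0 = 0
    · by_cases hv' : p₀.2.2 = 0
      · simp only [stepDuhamel_eq]
        refine continuous_fst.continuousWithinAt.mul
          (intervalIntegral.continuousWithinAt_of_dominated_interval (bound := fun _ => B)
          (Filter.Eventually.of_forall fun p => Measurable.aestronglyMeasurable ?_)
          (Filter.Eventually.of_forall fun p => Filter.Eventually.of_forall fun θ _ =>
            abs_stepTransport_le (n + 1) _ fun w _ => hB _ w)
          intervalIntegrable_const (Filter.Eventually.of_forall fun θ hθ => ?_))
        · exact measurable_stepTransport (n + 1) (g := fun θ => q (p.1 - p.1 * θ))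
            (hm.comp (Measurable.prodMk (by fun_prop) measurable_snd)) (by fun_prop)
            measurable_const
        · rw [uIoc_of_le zero_le_one] at hθ
          refine continuousWithinAt_stepTransport_of_velocity_zero hm hB hc hp₀ hv'
            (a := fun p => p.1 * θ) (b := fun p => p.1 - p.1 * θ) (by fun_prop) ?_ ?_ (n + 1)
          · intro p hp
            have := hp.1.1
            have := hp.1.2
            constructor <;> nlinarith [hθ.1, hθ.2]
          · intro p hp
            have := hp.1.1
            have := hp.1.2
            constructor <;> nlinarith [hθ.1, hθ.2]
      · refine (hfree p₀ hp₀).congr_of_eventuallyEq_of_mem ?_ hp₀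
        filter_upwards [(continuous_snd.tendsto p₀ |>.eventually (eventually_not_reflects T hv
          (not_onBoundary_of_mem hp₀.2 hv hv'))).filter_mono nhdsWithin_le_nhds,
          self_mem_nhdsWithin] with p hp hp'
        rw [stepDuhamel_eq]
        congr 1
        refine intervalIntegral.integral_congr fun θ hθ => ?_
        rw [uIcc_of_le zero_le_one] at hθ
        refine stepTransport_of_not_reflects (hp _ ?_) _ _
        have := hp'.1.1
        have := hp'.1.2
        nlinarith [hθ.1, hθ.2]
    · have hfl : ContinuousWithinAt flightTime (domain T) p₀ :=
        (continuousAt_flightTime hv).continuousWithinAt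
      have h1 : ContinuousWithinAt (fun p : ℝ × Phase =>
          ∫ ω, stepDuhamel n (p.1 - flightTime p) q (reflectPt p.2 ω) ∂reflectionLaw)
          (domain T) p₀ :=
        continuousWithinAt_integral_reflectPt (W := fun t z => stepDuhamel n t q z)
          (τ := fun p => p.1 - flightTime p) (measurable_stepDuhamel n hm)
          (fun t ht z => abs_stepDuhamel_le n hB ht z) ih hp₀ hv
          (continuous_fst.continuousWithinAt.sub hfl)
          fun p hp => ⟨sub_nonneg.2 (flightTime_le p),
            (sub_le_self _ (flightTime_nonneg hp.1.1)).trans hp.1.2⟩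
      have h2 := continuousWithinAt_free hm hB hc hp₀ hfl (fun p hp => flightTime_nonneg hp.1.1)
        fun p _ => flightTime_le p
      refine (h2.add h1).congr_of_eventuallyEq_of_mem ?_ hp₀
      filter_upwards [(continuous_snd.tendsto p₀ |>.eventually
        (eventually_apply_zero_ne hv)).filter_mono nhdsWithin_le_nhds, self_mem_nhdsWithin]
        with p hp hp'
      exact stepDuhamel_succ hm hB hp'.1.1 hp n

/-- Near a point, a fixed number of reflections suffices. -/
theorem exists_reflection_bound (T : ℝ) (p₀ : ℝ × Phase) :
    ∃ n : ℕ, ∀ᶠ p in nhdsWithin p₀ (domain T), p ∈ domain T ∧ p.1 * ‖p.2.2‖ ≤ n := by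
  obtain ⟨n, hn⟩ := exists_nat_ge (T * (‖p₀.2.2‖ + 1))
  refine ⟨n, ?_⟩
  have h : ∀ᶠ p : ℝ × Phase in nhds p₀, ‖p.2.2‖ < ‖p₀.2.2‖ + 1 :=
    (isOpen_lt (f := fun p : ℝ × Phase => ‖p.2.2‖) (by fun_prop) continuous_const).mem_nhds
      (lt_add_one ‖p₀.2.2‖)
  filter_upwards [h.filter_mono nhdsWithin_le_nhds, self_mem_nhdsWithin] with p hp hp'
  exact ⟨hp', (mul_le_mul hp'.1.2 hp.le (norm_nonneg _) (hp'.1.1.trans hp'.1.2)).trans hn⟩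

theorem continuousOn_transport {T B : ℝ} {f₀ : Phase → ℝ} (hf : Continuous f₀)
    (hd : DiffuseCondition f₀) (hB : ∀ z, |f₀ z| ≤ B) :
    ContinuousOn (fun p : ℝ × Phase => transport p.1 f₀ p.2) (domain T) := by
  intro p₀ hp₀
  obtain ⟨n, hn⟩ := exists_reflection_bound T p₀
  refine (continuousOn_stepTransport hf hd hB n p₀ hp₀).congr_of_eventuallyEq_of_mem ?_ hp₀
  filter_upwards [hn] with p hp
  exact transport_eq_stepTransport hp.2 f₀

theorem continuousOn_duhamel {T B : ℝ} {q : ℝ → Phase → ℝ}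
    (hm : Measurable fun p : ℝ × Phase => q p.1 p.2) (hB : ∀ t z, |q t z| ≤ B)
    (hc : ContinuousOn (fun p : ℝ × Phase => q p.1 p.2) (domain T)) :
    ContinuousOn (fun p : ℝ × Phase => duhamel p.1 q p.2) (domain T) := by
  intro p₀ hp₀
  obtain ⟨n, hn⟩ := exists_reflection_bound T p₀
  refine (continuousOn_stepDuhamel hm hB hc n p₀ hp₀).congr_of_eventuallyEq_of_mem ?_ hp₀
  filter_upwards [hn] with p hp
  exact duhamel_eq_stepDuhamel hp.1.1.1 hp.2 q

/-! ### Estimates of the collision operator -/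

/-- The bilinear form of the gain term. -/
def gainForm (g h : Phase → ℝ) (z : Phase) : ℝ :=
  ∫ p : Dir × Vel, g (z.1, scatter p.1 z.2 p.2) * h (z.1, scatterStar p.1 z.2 p.2) *
    max (inner ℝ (p.1 : Vel) (p.2 - z.2)) 0 ∂(surf.prod volume)

/-- The bilinear form of the loss term. -/
def lossForm (g h : Phase → ℝ) (z : Phase) : ℝ :=
  ∫ p : Dir × Vel, g z * h (z.1, p.2) *
    max (-(inner ℝ (p.1 : Vel) (p.2 - z.2))) 0 ∂(surf.prod volume)

theorem collision_eq (g : Phase → ℝ) (z : Phase) :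
    collision g z = gainForm g g z - lossForm g g z := rfl

theorem norm_dir (ν : Dir) : ‖(ν : Vel)‖ = 1 := by simp

/-- Conservation of kinetic energy, by which the gain term obeys the same bound as the loss term. -/
theorem norm_sq_scatter_add (ν : Dir) (v w : Vel) :
    ‖scatter ν v w‖ ^ 2 + ‖scatterStar ν v w‖ ^ 2 = ‖v‖ ^ 2 + ‖w‖ ^ 2 := by
  unfold scatter scatterStar
  rw [norm_sub_sq_real, norm_add_sq_real, norm_smul, norm_dir, inner_smul_right, inner_smul_right,
    inner_sub_right, real_inner_comm (ν : Vel) v, real_inner_comm (ν : Vel) w, mul_one,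
    Real.norm_eq_abs, sq_abs]
  ring

theorem abs_inner_dir_le (ν : Dir) (v w : Vel) :
    |inner ℝ (ν : Vel) (w - v)| ≤ (1 + ‖v‖) * (1 + ‖w‖) := by
  refine (abs_real_inner_le_norm _ _).trans ?_
  rw [norm_dir, one_mul]
  refine (norm_sub_le _ _).trans ?_
  nlinarith [norm_nonneg v, norm_nonneg w, mul_nonneg (norm_nonneg v) (norm_nonneg w)]

/-- The weight dominating the collision integrals. -/
def weight (b : ℝ) (w : Vel) : ℝ := (1 + ‖w‖) * Real.exp (-(b / 2) * ‖w‖ ^ 2)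

/-- The constant in the collision estimates. -/
def collisionConst (b : ℝ) : ℝ := ∫ p : Dir × Vel, weight b p.2 ∂(surf.prod volume)

theorem weight_nonneg (b : ℝ) (w : Vel) : 0 ≤ weight b w := by unfold weight; positivity

theorem continuous_weight (b : ℝ) : Continuous (weight b) := by unfold weight; fun_prop

theorem sq_mul_exp_le {c : ℝ} (hc : 0 < c) (x : ℝ) : x ^ 2 * Real.exp (-c * x ^ 2) ≤ 1 / c := by
  have h := Real.add_one_le_exp (c * x ^ 2)
  rw [neg_mul, Real.exp_neg, ← div_eq_mul_inv, div_le_div_iff₀ (Real.exp_pos _) hc]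
  linarith

/-- Half of the exponent absorbs the polynomial factor, through `1 + x ≤ 2 + x ^ 2`. -/
theorem weight_le {b : ℝ} (hb : 0 < b) (w : Vel) :
    weight b w ≤ (2 + 1 / (b / 4)) * Real.exp (-(b / 4) * ‖w‖ ^ 2) := by
  have e : Real.exp (-(b / 2) * ‖w‖ ^ 2) =
      Real.exp (-(b / 4) * ‖w‖ ^ 2) * Real.exp (-(b / 4) * ‖w‖ ^ 2) := by
    rw [← Real.exp_add]; ring_nf
  have h1 := sq_mul_exp_le (by positivity : 0 < b / 4) ‖w‖
  have h2 : Real.exp (-(b / 4) * ‖w‖ ^ 2) ≤ 1 := Real.exp_le_one_iff.2 (by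
    have : 0 ≤ b / 4 * ‖w‖ ^ 2 := by positivity
    linarith)
  have h3 : 1 + ‖w‖ ≤ 2 + ‖w‖ ^ 2 := by nlinarith [sq_nonneg (‖w‖ - 1), norm_nonneg w]
  unfold weight
  rw [e, ← mul_assoc]
  refine mul_le_mul_of_nonneg_right ?_ (Real.exp_pos _).le
  nlinarith [Real.exp_pos (-(b / 4) * ‖w‖ ^ 2)]

theorem integrable_weight {b : ℝ} (hb : 0 < b) :
    Integrable (fun p : Dir × Vel => weight b p.2) (surf.prod volume) := by
  have h : Integrable (fun w : Vel => Real.exp (-(b / 4) * ‖w‖ ^ 2)) := by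
    have := GaussianFourier.integrable_cexp_neg_mul_sq_norm_add (V := Vel) (b := ((b / 4 : ℝ) : ℂ))
      (by simpa using hb) 0 0
    refine (this.norm).congr (Filter.Eventually.of_forall fun w => ?_)
    simp only [zero_mul, add_zero, Complex.norm_exp]
    norm_cast
  have h2 : Integrable (weight b) := (h.const_mul (2 + 1 / (b / 4))).mono'
    (continuous_weight b).aestronglyMeasurable (Filter.Eventually.of_forall fun w => by
      rw [Real.norm_of_nonneg (weight_nonneg b w)]; exact weight_le hb w)
  exact h2.comp_snd surf

theorem collisionConst_nonneg (b : ℝ) : 0 ≤ collisionConst b :=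
  integral_nonneg fun _ => weight_nonneg _ _

theorem collisionConst_anti {b c : ℝ} (hb : 0 < b) (hbc : b ≤ c) :
    collisionConst c ≤ collisionConst b := by
  refine integral_mono (integrable_weight (hb.trans_le hbc)) (integrable_weight hb) fun p => ?_
  refine mul_le_mul_of_nonneg_left (Real.exp_le_exp.2 ?_) (by positivity)
  nlinarith [sq_nonneg ‖p.2‖]

theorem GaussianBound.nonneg {b A : ℝ} {g : Phase → ℝ} (h : GaussianBound b A g) : 0 ≤ A := by
  have := (abs_nonneg _).trans (h ((⟨0, by simp⟩, 0, 0), 0))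
  simpa using this

theorem abs_gain_integrand_le {b A B : ℝ} {g h : Phase → ℝ} (hg : GaussianBound b A g)
    (hh : GaussianBound b B h) (z : Phase) (p : Dir × Vel) :
    |g (z.1, scatter p.1 z.2 p.2) * h (z.1, scatterStar p.1 z.2 p.2) *
      max (inner ℝ (p.1 : Vel) (p.2 - z.2)) 0| ≤ A * B * weight b z.2 * weight b p.2 := by
  have h1 := hg (z.1, scatter p.1 z.2 p.2)
  have h2 := hh (z.1, scatterStar p.1 z.2 p.2)
  have h3 : |max (inner ℝ (p.1 : Vel) (p.2 - z.2)) 0| ≤ (1 + ‖z.2‖) * (1 + ‖p.2‖) := by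
    rw [abs_of_nonneg (le_max_right _ _)]
    exact max_le ((le_abs_self _).trans (abs_inner_dir_le _ _ _)) (by positivity)
  have e : Real.exp (-(b / 2) * ‖scatter p.1 z.2 p.2‖ ^ 2) *
      Real.exp (-(b / 2) * ‖scatterStar p.1 z.2 p.2‖ ^ 2) =
      Real.exp (-(b / 2) * ‖z.2‖ ^ 2) * Real.exp (-(b / 2) * ‖p.2‖ ^ 2) := by
    rw [← Real.exp_add, ← Real.exp_add, ← mul_add, ← mul_add, norm_sq_scatter_add]
  rw [abs_mul, abs_mul]
  calc _ ≤ (A * Real.exp (-(b / 2) * ‖scatter p.1 z.2 p.2‖ ^ 2)) *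
        (B * Real.exp (-(b / 2) * ‖scatterStar p.1 z.2 p.2‖ ^ 2)) *
        ((1 + ‖z.2‖) * (1 + ‖p.2‖)) := by
        exact mul_le_mul (mul_le_mul h1 h2 (abs_nonneg _) ((abs_nonneg _).trans h1)) h3
          (abs_nonneg _) (mul_nonneg ((abs_nonneg _).trans h1) ((abs_nonneg _).trans h2))
    _ = A * B * (Real.exp (-(b / 2) * ‖scatter p.1 z.2 p.2‖ ^ 2) *
        Real.exp (-(b / 2) * ‖scatterStar p.1 z.2 p.2‖ ^ 2)) *
        ((1 + ‖z.2‖) * (1 + ‖p.2‖)) := by ring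
    _ = _ := by rw [e]; unfold weight; ring

theorem abs_loss_integrand_le {b A B : ℝ} {g h : Phase → ℝ} (hg : GaussianBound b A g)
    (hh : GaussianBound b B h) (z : Phase) (p : Dir × Vel) :
    |g z * h (z.1, p.2) * max (-(inner ℝ (p.1 : Vel) (p.2 - z.2))) 0| ≤
      A * B * weight b z.2 * weight b p.2 := by
  have h1 := hg z
  have h2 := hh (z.1, p.2)
  have h3 : |max (-(inner ℝ (p.1 : Vel) (p.2 - z.2))) 0| ≤ (1 + ‖z.2‖) * (1 + ‖p.2‖) := by
    rw [abs_of_nonneg (le_max_right _ _)]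
    exact max_le ((neg_le_abs _).trans (abs_inner_dir_le _ _ _)) (by positivity)
  rw [abs_mul, abs_mul]
  calc _ ≤ (A * Real.exp (-(b / 2) * ‖z.2‖ ^ 2)) * (B * Real.exp (-(b / 2) * ‖p.2‖ ^ 2)) *
        ((1 + ‖z.2‖) * (1 + ‖p.2‖)) := by
        exact mul_le_mul (mul_le_mul h1 h2 (abs_nonneg _) ((abs_nonneg _).trans h1)) h3
          (abs_nonneg _) (mul_nonneg ((abs_nonneg _).trans h1) ((abs_nonneg _).trans h2))
    _ = _ := by unfold weight; ring

theorem continuous_scatter : Continuous fun p : Vel × Dir × Vel => scatter p.2.1 p.1 p.2.2 := by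
  unfold scatter; fun_prop

theorem continuous_scatterStar :
    Continuous fun p : Vel × Dir × Vel => scatterStar p.2.1 p.1 p.2.2 := by
  unfold scatterStar; fun_prop

theorem measurable_inner_relative {X : Type*} [MeasurableSpace X] :
    Measurable fun p : (X × Phase) × (Dir × Vel) =>
      (inner ℝ (p.2.1 : Vel) (p.2.2 - p.1.2.2) : ℝ) :=
  Measurable.inner (measurable_subtype_coe.comp (measurable_fst.comp measurable_snd))
    (by fun_prop)

theorem measurable_gain_integrand {X : Type*} [MeasurableSpace X] {g h : X → Phase → ℝ}
    (hg : Measurable fun p : X × Phase => g p.1 p.2)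
    (hh : Measurable fun p : X × Phase => h p.1 p.2) :
    Measurable fun p : (X × Phase) × (Dir × Vel) =>
      g p.1.1 (p.1.2.1, scatter p.2.1 p.1.2.2 p.2.2) *
      h p.1.1 (p.1.2.1, scatterStar p.2.1 p.1.2.2 p.2.2) *
      max (inner ℝ (p.2.1 : Vel) (p.2.2 - p.1.2.2)) 0 := by
  have h0 : Measurable fun p : (X × Phase) × (Dir × Vel) => (p.1.2.2, p.2) := by fun_prop
  have h1 : Measurable fun p : (X × Phase) × (Dir × Vel) => scatter p.2.1 p.1.2.2 p.2.2 :=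
    continuous_scatter.measurable.comp h0
  have h2 : Measurable fun p : (X × Phase) × (Dir × Vel) => scatterStar p.2.1 p.1.2.2 p.2.2 :=
    continuous_scatterStar.measurable.comp h0
  have h3 : Measurable fun p : (X × Phase) × (Dir × Vel) => p.1.1 := by fun_prop
  have h4 : Measurable fun p : (X × Phase) × (Dir × Vel) => p.1.2.1 := by fun_prop
  refine Measurable.mul (Measurable.mul ?_ ?_) ?_
  · exact Measurable.comp (g := fun p : X × Phase => g p.1 p.2)
      (f := fun p : (X × Phase) × (Dir × Vel) => (p.1.1, p.1.2.1, scatter p.2.1 p.1.2.2 p.2.2)) hg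
      (h3.prodMk (h4.prodMk h1))
  · exact Measurable.comp (g := fun p : X × Phase => h p.1 p.2)
      (f := fun p : (X × Phase) × (Dir × Vel) => (p.1.1, p.1.2.1, scatterStar p.2.1 p.1.2.2 p.2.2))
      hh (h3.prodMk (h4.prodMk h2))
  · exact measurable_inner_relative.max measurable_const

theorem measurable_loss_integrand {X : Type*} [MeasurableSpace X] {g h : X → Phase → ℝ}
    (hg : Measurable fun p : X × Phase => g p.1 p.2)
    (hh : Measurable fun p : X × Phase => h p.1 p.2) :
    Measurable fun p : (X × Phase) × (Dir × Vel) =>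
      g p.1.1 p.1.2 * h p.1.1 (p.1.2.1, p.2.2) *
      max (-(inner ℝ (p.2.1 : Vel) (p.2.2 - p.1.2.2))) 0 := by
  have h1 : Measurable fun p : (X × Phase) × (Dir × Vel) => (p.1.1, p.1.2.1, p.2.2) := by fun_prop
  refine Measurable.mul (Measurable.mul ?_ ?_) ?_
  · exact Measurable.comp (g := fun p : X × Phase => g p.1 p.2) hg measurable_fst
  · exact Measurable.comp (g := fun p : X × Phase => h p.1 p.2) hh h1
  · exact measurable_inner_relative.neg.max measurable_const

theorem measurable_collision {X : Type*} [MeasurableSpace X] {g : X → Phase → ℝ}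
    (hg : Measurable fun p : X × Phase => g p.1 p.2) :
    Measurable fun p : X × Phase => collision (g p.1) p.2 :=
  (measurable_gain_integrand hg hg).stronglyMeasurable.integral_prod_right'.measurable.sub
    (measurable_loss_integrand hg hg).stronglyMeasurable.integral_prod_right'.measurable

theorem aestronglyMeasurable_gain {g h : Phase → ℝ} (hg : Measurable g) (hh : Measurable h)
    (z : Phase) : AEStronglyMeasurable (fun p : Dir × Vel => g (z.1, scatter p.1 z.2 p.2) *
      h (z.1, scatterStar p.1 z.2 p.2) * max (inner ℝ (p.1 : Vel) (p.2 - z.2)) 0)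
      (surf.prod volume) := by
  have hm := (measurable_gain_integrand (X := Unit) (g := fun _ => g) (h := fun _ => h)
    (hg.comp measurable_snd) (hh.comp measurable_snd)).comp
    (measurable_prodMk_left (x := ((), z)))
  exact hm.aestronglyMeasurable

theorem aestronglyMeasurable_loss {g h : Phase → ℝ} (hh : Measurable h)
    (z : Phase) : AEStronglyMeasurable (fun p : Dir × Vel => g z * h (z.1, p.2) *
      max (-(inner ℝ (p.1 : Vel) (p.2 - z.2))) 0) (surf.prod volume) := by
  have hm := (measurable_loss_integrand (X := Unit) (g := fun _ _ => g z) (h := fun _ => h)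
    measurable_const (hh.comp measurable_snd)).comp
    (measurable_prodMk_left (x := ((), z)))
  exact hm.aestronglyMeasurable

theorem integrable_gain {b A B : ℝ} (hb : 0 < b) {g h : Phase → ℝ} (hgm : Measurable g)
    (hhm : Measurable h) (hg : GaussianBound b A g) (hh : GaussianBound b B h) (z : Phase) :
    Integrable (fun p : Dir × Vel => g (z.1, scatter p.1 z.2 p.2) *
      h (z.1, scatterStar p.1 z.2 p.2) * max (inner ℝ (p.1 : Vel) (p.2 - z.2)) 0)
      (surf.prod volume) := by
  exact ((integrable_weight hb).const_mul (A * B * weight b z.2)).mono' (aestronglyMeasurable_gain hgm hhm z)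
    (Filter.Eventually.of_forall fun p => abs_gain_integrand_le hg hh z p)

theorem integrable_loss {b A B : ℝ} (hb : 0 < b) {g h : Phase → ℝ}
    (hhm : Measurable h) (hg : GaussianBound b A g) (hh : GaussianBound b B h) (z : Phase) :
    Integrable (fun p : Dir × Vel => g z * h (z.1, p.2) *
      max (-(inner ℝ (p.1 : Vel) (p.2 - z.2))) 0) (surf.prod volume) := by
  exact ((integrable_weight hb).const_mul (A * B * weight b z.2)).mono' (aestronglyMeasurable_loss hhm z)
    (Filter.Eventually.of_forall fun p => abs_loss_integrand_le hg hh z p)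

theorem abs_gainForm_le {b A B : ℝ} (hb : 0 < b) {g h : Phase → ℝ} (hg : GaussianBound b A g)
    (hh : GaussianBound b B h) (z : Phase) :
    |gainForm g h z| ≤ A * B * weight b z.2 * collisionConst b := by
  rw [collisionConst, ← integral_const_mul, gainForm, ← Real.norm_eq_abs]
  exact norm_integral_le_of_norm_le ((integrable_weight hb).const_mul _)
    (Filter.Eventually.of_forall fun p => abs_gain_integrand_le hg hh z p)

theorem abs_lossForm_le {b A B : ℝ} (hb : 0 < b) {g h : Phase → ℝ} (hg : GaussianBound b A g)
    (hh : GaussianBound b B h) (z : Phase) :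
    |lossForm g h z| ≤ A * B * weight b z.2 * collisionConst b := by
  rw [collisionConst, ← integral_const_mul, lossForm, ← Real.norm_eq_abs]
  exact norm_integral_le_of_norm_le ((integrable_weight hb).const_mul _)
    (Filter.Eventually.of_forall fun p => abs_loss_integrand_le hg hh z p)

/-- Polarization: gain and loss are bilinear, so each difference splits into two terms with one
factor `g - h`. The `4` counts these terms. -/
theorem abs_collision_sub_le {b M D : ℝ} (hb : 0 < b) {g h : Phase → ℝ} (hgm : Measurable g)
    (hhm : Measurable h) (hg : GaussianBound b M g) (hh : GaussianBound b M h)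
    (hgh : GaussianBound b D (fun z => g z - h z)) (z : Phase) :
    |collision g z - collision h z| ≤ 4 * D * M * collisionConst b * weight b z.2 := by
  have hghm : Measurable fun z => g z - h z := hgm.sub hhm
  have e1 : gainForm g g z - gainForm h h z =
      gainForm (fun z => g z - h z) g z + gainForm h (fun z => g z - h z) z := by
    unfold gainForm
    rw [← integral_sub (integrable_gain hb hgm hgm hg hg z) (integrable_gain hb hhm hhm hh hh z),
      ← integral_add (integrable_gain hb hghm hgm hgh hg z)
        (integrable_gain hb hhm hghm hh hgh z)]
    congr 1
    funext p
    ring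
  have e2 : lossForm g g z - lossForm h h z =
      lossForm (fun z => g z - h z) g z + lossForm h (fun z => g z - h z) z := by
    unfold lossForm
    rw [← integral_sub (integrable_loss hb hgm hg hg z) (integrable_loss hb hhm hh hh z),
      ← integral_add (integrable_loss hb hgm hgh hg z)
        (integrable_loss hb hghm hh hgh z)]
    congr 1
    funext p
    ring
  have e3 : collision g z - collision h z =
      gainForm (fun z => g z - h z) g z + gainForm h (fun z => g z - h z) z -
      (lossForm (fun z => g z - h z) g z + lossForm h (fun z => g z - h z) z) := by
    rw [collision_eq, collision_eq, ← e1, ← e2]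
    ring
  have h1 := abs_le.1 (abs_gainForm_le hb hgh hg z)
  have h2 := abs_le.1 (abs_gainForm_le hb hh hgh z)
  have h3 := abs_le.1 (abs_lossForm_le hb hgh hg z)
  have h4 := abs_le.1 (abs_lossForm_le hb hh hgh z)
  rw [e3, abs_le]
  constructor <;> nlinarith [h1.1, h1.2, h2.1, h2.2, h3.1, h3.2, h4.1, h4.2]

theorem abs_collision_le {b M : ℝ} (hb : 0 < b) {g : Phase → ℝ} (hg : GaussianBound b M g)
    (z : Phase) : |collision g z| ≤ 2 * M * M * collisionConst b * weight b z.2 := by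
  have h1 := abs_le.1 (abs_gainForm_le hb hg hg z)
  have h3 := abs_le.1 (abs_lossForm_le hb hg hg z)
  rw [collision_eq, abs_le]
  constructor <;> nlinarith [h1.1, h1.2, h3.1, h3.2]

/-! ### Continuity of the collision operator -/

theorem volume_hyperplane {a : Vel} (ha : a ≠ 0) (c : ℝ) :
    volume {w : Vel | inner ℝ a w = c} = 0 := by
  let H : AffineSubspace ℝ Vel :=
    { carrier := {w | inner ℝ a w = c}
      smul_vsub_vadd_mem' := fun r p₁ p₂ p₃ h₁ h₂ h₃ => by
        have h₁' : inner ℝ a p₁ = c := h₁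
        have h₂' : inner ℝ a p₂ = c := h₂
        have h₃' : inner ℝ a p₃ = c := h₃
        show inner ℝ a (r • (p₁ - p₂) + p₃) = c
        rw [inner_add_right, inner_smul_right, inner_sub_right, h₁', h₂', h₃']
        ring }
  refine Measure.addHaar_affineSubspace volume H fun h => ha ?_
  have h0 : (0 : Vel) ∈ H := h ▸ AffineSubspace.mem_top ℝ Vel 0
  have h1 : a ∈ H := h ▸ AffineSubspace.mem_top ℝ Vel a
  have h0' : inner ℝ a (0 : Vel) = c := h0
  have h1' : inner ℝ a a = c := h1
  rw [inner_zero_right] at h0'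
  rw [← h0'] at h1'
  exact inner_self_eq_zero.1 h1'

/-- For almost every fixed `ν`, each condition fails only for `w` in an affine hyperplane, which is
Lebesgue null. -/
theorem ae_scatter_ne_zero (v : Vel) : ∀ᵐ p : Dir × Vel ∂(surf.prod volume),
    scatter p.1 v p.2 0 ≠ 0 ∧ scatterStar p.1 v p.2 0 ≠ 0 ∧ p.2 0 ≠ 0 := by
  have hs1 : Continuous fun p : Dir × Vel => scatter p.1 v p.2 0 :=
    (by fun_prop : Continuous fun w : Vel => w 0).comp
      (continuous_scatter.comp (by fun_prop : Continuous fun p : Dir × Vel => (v, p)))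
  have hs2 : Continuous fun p : Dir × Vel => scatterStar p.1 v p.2 0 :=
    (by fun_prop : Continuous fun w : Vel => w 0).comp
      (continuous_scatterStar.comp (by fun_prop : Continuous fun p : Dir × Vel => (v, p)))
  have hs3 : Continuous fun p : Dir × Vel => p.2 0 := by fun_prop
  have hms : MeasurableSet {p : Dir × Vel | scatter p.1 v p.2 0 ≠ 0 ∧
      scatterStar p.1 v p.2 0 ≠ 0 ∧ p.2 0 ≠ 0} :=
    (((isOpen_ne_fun hs1 continuous_const).inter ((isOpen_ne_fun hs2 continuous_const).inter
      (isOpen_ne_fun hs3 continuous_const)))).measurableSet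
  refine (Measure.ae_prod_iff_ae_ae hms).2 ?_
  filter_upwards [ae_surf_coord_ne_zero 0, ae_surf_coord_ne_zero 1] with ν h0 h1
  have hν : (ν : Vel) ≠ 0 := fun h => h0 (by rw [h]; rfl)
  have ha1 : (ν : Vel) 0 • (ν : Vel) ≠ 0 := smul_ne_zero h0 hν
  -- The coordinate of index `1` of this normal vector is `-(ν 0 * ν 1)`; hence the requirement that
  -- both coordinates of `ν` be nonzero.
  have ha2 : EuclideanSpace.single (0 : Fin 3) (1 : ℝ) - (ν : Vel) 0 • (ν : Vel) ≠ 0 := fun h => by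
    have := congrArg (fun w : Vel => w 1) h
    simp at this
    exact this.elim h0 h1
  have he : EuclideanSpace.single (0 : Fin 3) (1 : ℝ) ≠ (0 : Vel) := by simp
  filter_upwards [measure_eq_zero_iff_ae_notMem.1 (volume_hyperplane ha1
      (inner ℝ (ν : Vel) v * (ν : Vel) 0 - v 0)),
    measure_eq_zero_iff_ae_notMem.1 (volume_hyperplane ha2 (-(inner ℝ (ν : Vel) v * (ν : Vel) 0))),
    measure_eq_zero_iff_ae_notMem.1 (volume_hyperplane he 0)] with w k1 k2 k3
  simp only [inner_smul_left, inner_sub_left, EuclideanSpace.inner_single_left,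
    conj_trivial, one_mul] at k1 k2 k3
  refine ⟨fun h => k1 ?_, fun h => k2 ?_, k3⟩
  · simp only [scatter, PiLp.sub_apply, PiLp.smul_apply, smul_eq_mul, inner_sub_right] at h
    linarith
  · simp only [scatterStar, PiLp.add_apply, PiLp.smul_apply, smul_eq_mul, inner_sub_right] at h
    linarith

theorem continuousWithinAt_comp_velocity {T : ℝ} {u : ℝ → Phase → ℝ}
    (hc : ContinuousOn (fun p : ℝ × Phase => u p.1 p.2) (domain T)) {p₀ : ℝ × Phase}
    (hp₀ : p₀ ∈ domain T) {G : Vel → Vel} (hG : Continuous G) (h0 : G p₀.2.2 0 ≠ 0) :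
    ContinuousWithinAt (fun p : ℝ × Phase => u p.1 (p.2.1, G p.2.2)) (domain T) p₀ := by
  have hF : Continuous fun p : ℝ × Phase => (p.1, ((p.2.1, G p.2.2) : Phase)) := by fun_prop
  refine Filter.Tendsto.comp (hc (p₀.1, (p₀.2.1, G p₀.2.2)) ⟨hp₀.1, mem_compl_grazing_of_ne h0⟩)
    (tendsto_nhdsWithin_iff.2 ⟨hF.continuousWithinAt, ?_⟩)
  have hev : ∀ᶠ p : ℝ × Phase in nhds p₀, G p.2.2 0 ≠ 0 :=
    (isOpen_ne_fun (by fun_prop : Continuous fun p : ℝ × Phase => G p.2.2 0)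
      continuous_const).mem_nhds h0
  filter_upwards [hev.filter_mono nhdsWithin_le_nhds, self_mem_nhdsWithin] with p hp hp'
  exact ⟨hp'.1, mem_compl_grazing_of_ne hp⟩

theorem weight_le_const {b : ℝ} (hb : 0 < b) (w : Vel) : weight b w ≤ 2 + 1 / (b / 4) := by
  refine (weight_le hb w).trans (mul_le_of_le_one_right (by positivity) ?_)
  refine Real.exp_le_one_iff.2 ?_
  have : 0 ≤ b / 4 * ‖w‖ ^ 2 := by positivity
  linarith

/-- Dominated convergence with the integrable `weight`. Discontinuities of `u` at grazing points are
invisible, since almost every velocity in the integrand has nonzero first component. -/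
theorem continuousOn_collision {T b M : ℝ} (hb : 0 < b) {u : ℝ → Phase → ℝ}
    (hm : Measurable fun p : ℝ × Phase => u p.1 p.2) (hG : ∀ t ∈ Icc 0 T, GaussianBound b M (u t))
    (hc : ContinuousOn (fun p : ℝ × Phase => u p.1 p.2) (domain T)) :
    ContinuousOn (fun p : ℝ × Phase => collision (u p.1) p.2) (domain T) := by
  intro p₀ hp₀
  have hM : 0 ≤ M := (hG p₀.1 hp₀.1).nonneg
  have hw : ∀ (z : Phase) (x : Dir × Vel), M * M * weight b z.2 * weight b x.2 ≤
      M * M * (2 + 1 / (b / 4)) * weight b x.2 := fun z x =>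
    mul_le_mul_of_nonneg_right (mul_le_mul_of_nonneg_left (weight_le_const hb _) (by positivity))
      (weight_nonneg _ _)
  have hu : ∀ t, Measurable (u t) := fun t => hm.comp measurable_prodMk_left
  have hint : Integrable (fun x : Dir × Vel => M * M * (2 + 1 / (b / 4)) * weight b x.2)
      (surf.prod volume) := (integrable_weight hb).const_mul (M * M * (2 + 1 / (b / 4)))
  refine ContinuousWithinAt.sub (f := fun p : ℝ × Phase => collisionGain (u p.1) p.2)
    (g := fun p : ℝ × Phase => collisionLoss (u p.1) p.2) ?_ ?_
  · unfold collisionGain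
    refine continuousWithinAt_of_dominated (μ := surf.prod volume)
      (F := fun (p : ℝ × Phase) (x : Dir × Vel) => u p.1 (p.2.1, scatter x.1 p.2.2 x.2) *
        u p.1 (p.2.1, scatterStar x.1 p.2.2 x.2) * max (inner ℝ (x.1 : Vel) (x.2 - p.2.2)) 0)
      (bound := fun x => M * M * (2 + 1 / (b / 4)) * weight b x.2)
      (Filter.Eventually.of_forall fun p => ?_) ?_ hint ?_
    · exact aestronglyMeasurable_gain (hu p.1) (hu p.1) p.2
    · filter_upwards [self_mem_nhdsWithin] with p hp
      exact Filter.Eventually.of_forall fun x =>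
        (abs_gain_integrand_le (hG _ hp.1) (hG _ hp.1) p.2 x).trans (hw _ _)
    · filter_upwards [ae_scatter_ne_zero p₀.2.2] with x hx
      refine ContinuousWithinAt.mul (ContinuousWithinAt.mul ?_ ?_) ?_
      · exact continuousWithinAt_comp_velocity hc hp₀ (G := fun v => scatter x.1 v x.2)
          (continuous_scatter.comp (by fun_prop : Continuous fun v : Vel => (v, x))) hx.1
      · exact continuousWithinAt_comp_velocity hc hp₀ (G := fun v => scatterStar x.1 v x.2)
          (continuous_scatterStar.comp (by fun_prop : Continuous fun v : Vel => (v, x))) hx.2.1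
      · exact Continuous.continuousWithinAt (by fun_prop)
  · unfold collisionLoss
    refine continuousWithinAt_of_dominated (μ := surf.prod volume)
      (F := fun (p : ℝ × Phase) (x : Dir × Vel) => u p.1 p.2 * u p.1 (p.2.1, x.2) *
        max (-(inner ℝ (x.1 : Vel) (x.2 - p.2.2))) 0)
      (bound := fun x => M * M * (2 + 1 / (b / 4)) * weight b x.2)
      (Filter.Eventually.of_forall fun p => ?_) ?_ hint ?_
    · exact aestronglyMeasurable_loss (hu p.1) p.2
    · filter_upwards [self_mem_nhdsWithin] with p hp
      exact Filter.Eventually.of_forall fun x =>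
        (abs_loss_integrand_le (hG _ hp.1) (hG _ hp.1) p.2 x).trans (hw _ _)
    · filter_upwards [ae_scatter_ne_zero p₀.2.2] with x hx
      refine ContinuousWithinAt.mul (ContinuousWithinAt.mul (hc p₀ hp₀) ?_) ?_
      · exact continuousWithinAt_comp_velocity hc hp₀ (G := fun _ => x.2) continuous_const hx.2.2
      · exact Continuous.continuousWithinAt (by fun_prop)

/-! ### The mild formulation -/

/-- The right-hand side of the mild formulation. -/
def mildMap (f₀ : Phase → ℝ) (u : ℝ → Phase → ℝ) (t : ℝ) (z : Phase) : ℝ :=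
  transport t f₀ z + duhamel t (fun τ => collision (u τ)) z

theorem measurable_mildMap {f₀ : Phase → ℝ} (hf : Measurable f₀) {u : ℝ → Phase → ℝ}
    (hm : Measurable fun p : ℝ × Phase => u p.1 p.2) :
    Measurable fun p : ℝ × Phase => mildMap f₀ u p.1 p.2 :=
  (measurable_transport (g := fun _ => f₀) (hf.comp measurable_snd) measurable_fst
    measurable_snd).add (measurable_duhamel (measurable_collision hm))

theorem duhamel_congr {t : ℝ} (ht : 0 ≤ t) {q r : ℝ → Phase → ℝ}
    (h : ∀ τ ∈ Icc 0 t, q τ = r τ) (z : Phase) : duhamel t q z = duhamel t r z := by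
  refine intervalIntegral.integral_congr fun τ hτ => ?_
  rw [uIcc_of_le ht] at hτ
  simp only [h τ hτ]

theorem mildMap_congr {t : ℝ} (ht : 0 ≤ t) (f₀ : Phase → ℝ) {u w : ℝ → Phase → ℝ}
    (h : ∀ τ ∈ Icc 0 t, u τ = w τ) (z : Phase) : mildMap f₀ u t z = mildMap f₀ w t z := by
  unfold mildMap
  rw [duhamel_congr ht (fun τ hτ => by rw [h τ hτ]) z]

theorem GaussianBound.mono {b c A B : ℝ} {g : Phase → ℝ} (h : GaussianBound b A g) (hbc : c ≤ b)
    (hAB : A ≤ B) : GaussianBound c B g := fun z => by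
  refine (h z).trans (mul_le_mul hAB (Real.exp_le_exp.2 ?_) (Real.exp_pos _).le
    (h.nonneg.trans hAB))
  nlinarith [sq_nonneg ‖z.2‖]

theorem GaussianBound.abs_le {b A : ℝ} {g : Phase → ℝ} (h : GaussianBound b A g) (hb : 0 ≤ b)
    (z : Phase) : |g z| ≤ A := by
  refine (h z).trans (mul_le_of_le_one_right h.nonneg (Real.exp_le_one_iff.2 ?_))
  have : 0 ≤ b / 2 * ‖z.2‖ ^ 2 := by positivity
  linarith

theorem GaussianBound.transport {b A : ℝ} {g : Phase → ℝ} (h : GaussianBound b A g) (t : ℝ) :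
    GaussianBound b A (transport t g) := fun z =>
  abs_transport_le t fun w hw => by rw [← hw]; exact h w

theorem continuousOn_mildMap {T b M B : ℝ} (hT : 0 ≤ T) (hb : 0 < b) {f₀ : Phase → ℝ}
    (hf : Continuous f₀) (hd : DiffuseCondition f₀) (hB : ∀ z, |f₀ z| ≤ B) {u : ℝ → Phase → ℝ}
    (hm : Measurable fun p : ℝ × Phase => u p.1 p.2) (hG : ∀ t ∈ Icc 0 T, GaussianBound b M (u t))
    (hc : ContinuousOn (fun p : ℝ × Phase => u p.1 p.2) (domain T)) :
    ContinuousOn (fun p : ℝ × Phase => mildMap f₀ u p.1 p.2) (domain T) := by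
  refine (continuousOn_transport hf hd hB).add ?_
  -- The bounds on `u` hold on `[0,T]` only, while `continuousOn_duhamel` wants a source bounded at
  -- all times; clamping time changes nothing on `[0,T]`.
  set q : ℝ → Phase → ℝ := fun τ => collision (u (projIcc 0 T hT τ)) with hq
  have hqm : Measurable fun p : ℝ × Phase => q p.1 p.2 := by
    have hp : Measurable fun p : ℝ × Phase => (((projIcc 0 T hT p.1 : Icc 0 T) : ℝ), p.2) :=
      (continuous_subtype_val.comp (continuous_projIcc.comp continuous_fst)).measurable.prodMk
        measurable_snd
    exact (measurable_collision hm).comp hp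
  have hqB : ∀ t z, |q t z| ≤ 2 * M * M * collisionConst b * (2 + 1 / (b / 4)) := fun t z => by
    have hu := hG _ (projIcc 0 T hT t).2
    have := hu.nonneg
    have := collisionConst_nonneg b
    exact (abs_collision_le hb hu z).trans
      (mul_le_mul_of_nonneg_left (weight_le_const hb _) (by positivity))
  have hqe : ∀ t ∈ Icc 0 T, q t = collision (u t) := fun t ht => by
    rw [hq]; simp only [projIcc_of_mem hT ht]
  have hqc : ContinuousOn (fun p : ℝ × Phase => q p.1 p.2) (domain T) :=
    (continuousOn_collision hb hm hG hc).congr fun p hp => by rw [hqe _ hp.1]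
  refine (continuousOn_duhamel hqm hqB hqc).congr fun p hp => ?_
  exact duhamel_congr hp.1.1 (fun τ hτ => (hqe τ ⟨hτ.1, hτ.2.trans hp.1.2⟩).symm) _

/-! ### The contraction estimate -/

/-- The decreasing rate of the Gaussian weight, losing `b / 2` during the time `δ` after `a`. -/
def rate (a δ b τ : ℝ) : ℝ := b - b / (2 * δ) * max (τ - a) 0

theorem rate_le {a δ b : ℝ} (hδ : 0 < δ) (hb : 0 < b) (τ : ℝ) : rate a δ b τ ≤ b := by
  unfold rate
  have : 0 ≤ b / (2 * δ) * max (τ - a) 0 := by positivity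
  linarith

theorem half_le_rate {a δ b τ : ℝ} (hδ : 0 < δ) (hb : 0 < b) (hτ : τ ≤ a + δ) :
    b / 2 ≤ rate a δ b τ := by
  unfold rate
  have h1 : max (τ - a) 0 ≤ δ := max_le (by linarith) hδ.le
  have h2 : b / (2 * δ) * max (τ - a) 0 ≤ b / (2 * δ) * δ :=
    mul_le_mul_of_nonneg_left h1 (by positivity)
  have h3 : b / (2 * δ) * δ = b / 2 := by field_simp
  linarith

theorem intervalIntegrable_transport_collision {b M t : ℝ} (hb : 0 < b) (ht : 0 ≤ t)
    {u : ℝ → Phase → ℝ} (hm : Measurable fun p : ℝ × Phase => u p.1 p.2)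
    (hG : ∀ τ ∈ Icc 0 t, GaussianBound b M (u τ)) (z : Phase) :
    IntervalIntegrable (fun τ => transport (t - τ) (collision (u τ)) z) volume 0 t := by
  rw [intervalIntegrable_iff, uIoc_of_le ht]
  have hm' : Measurable fun τ => transport (t - τ) (collision (u τ)) z :=
    measurable_transport (measurable_collision hm) (by fun_prop) measurable_const
  refine Measure.integrableOn_of_bounded (M := 2 * M * M * collisionConst b * weight b z.2)
    (by simp) hm'.aestronglyMeasurable ?_
  rw [ae_restrict_iff' measurableSet_Ioc]
  refine Filter.Eventually.of_forall fun τ hτ => abs_transport_le _ fun w hw => ?_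
  have h := abs_collision_le hb (hG τ ⟨hτ.1.le, hτ.2⟩) w
  rwa [weight, hw, ← weight] at h

/-- The factor `V ^ 2` is, up to `2 / c`, the derivative of the exponent, so the bound is uniform in
`V`. This uniformity pays for the unbounded kernel. -/
theorem integral_rate_le {a t c V : ℝ} (hc : 0 < c) :
    ∫ τ in a..t, (2 + V ^ 2 * Real.exp (-(c / 2 * V ^ 2 * (t - τ)))) ≤ 2 * (t - a) + 2 / c := by
  have hd : ∀ τ ∈ uIcc a t, HasDerivAt
      (fun τ => 2 * τ + 2 / c * Real.exp (-(c / 2 * V ^ 2 * (t - τ))))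
      (2 + V ^ 2 * Real.exp (-(c / 2 * V ^ 2 * (t - τ)))) τ := fun τ _ => by
    have h1 : HasDerivAt (fun τ : ℝ => -(c / 2 * V ^ 2 * (t - τ))) (c / 2 * V ^ 2) τ := by
      have := (((hasDerivAt_id τ).const_sub t).const_mul (c / 2 * V ^ 2)).fun_neg
      simpa using this
    have h2 := ((hasDerivAt_id τ).const_mul 2).add (h1.exp.const_mul (2 / c))
    refine h2.congr_deriv ?_
    field_simp
  rw [intervalIntegral.integral_eq_sub_of_hasDerivAt hd
    (Continuous.intervalIntegrable (by fun_prop) _ _)]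
  have h3 : 0 ≤ 2 / c * Real.exp (-(c / 2 * V ^ 2 * (t - a))) := by positivity
  simp only [sub_self, mul_zero, neg_zero, Real.exp_zero, mul_one]
  linarith

/-- The time step for which the mild map is a contraction with constant `1 / 2`. -/
theorem exists_contraction_step {b M : ℝ} (hb : 0 < b) (hM : 0 ≤ M) :
    ∃ δ > 0, 4 * M * collisionConst (b / 2) * (2 * δ + 4 * δ / b) ≤ 1 / 2 := by
  have hK := collisionConst_nonneg (b / 2)
  set X := 4 * M * collisionConst (b / 2) * (2 + 4 / b) with hX
  have hX0 : 0 ≤ X := by positivity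
  refine ⟨1 / (2 * (X + 1)), by positivity, ?_⟩
  have e : 4 * M * collisionConst (b / 2) * (2 * (1 / (2 * (X + 1))) +
      4 * (1 / (2 * (X + 1))) / b) = X * (1 / (2 * (X + 1))) := by rw [hX]; ring
  rw [e, mul_one_div, div_le_div_iff₀ (by positivity) two_pos]
  linarith

/-- The transported datum cancels, and times before `a` contribute nothing. After `a`, the Gaussian
at time `τ` is sharper than the one at `t`, and this surplus compensates the growth of `weight`. All
rates stay above `b / 2`, so `collisionConst (b / 2)` serves for every `τ`. -/
theorem mildMap_contraction {a δ b M D T : ℝ} (ha : 0 ≤ a) (hδ : 0 < δ) (hb : 0 < b)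
    (hsmall : 4 * M * collisionConst (b / 2) * (2 * δ + 4 * δ / b) ≤ 1 / 2) (hT : T ≤ a + δ)
    {u w : ℝ → Phase → ℝ} (hum : Measurable fun p : ℝ × Phase => u p.1 p.2)
    (hwm : Measurable fun p : ℝ × Phase => w p.1 p.2)
    (hu : ∀ τ ∈ Icc 0 T, GaussianBound (rate a δ b τ) M (u τ))
    (hw : ∀ τ ∈ Icc 0 T, GaussianBound (rate a δ b τ) M (w τ))
    (huw : ∀ τ ∈ Icc 0 T, GaussianBound (rate a δ b τ) D (fun z => u τ z - w τ z))
    (heq : ∀ τ ∈ Ico 0 a, u τ = w τ) (f₀ : Phase → ℝ) {t : ℝ} (ht : t ∈ Icc 0 T) :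
    GaussianBound (rate a δ b t) (D / 2) (fun z => mildMap f₀ u t z - mildMap f₀ w t z) := by
  intro z
  show |mildMap f₀ u t z - mildMap f₀ w t z| ≤ _
  have hM : 0 ≤ M := (hu t ht).nonneg
  have hD : 0 ≤ D := (huw t ht).nonneg
  rcases lt_or_ge t a with hta | hat
  · rw [mildMap_congr ht.1 f₀ (fun τ hτ => heq τ ⟨hτ.1, hτ.2.trans_lt hta⟩), sub_self, abs_zero]
    positivity
  have hmem : ∀ τ ∈ Icc 0 t, τ ∈ Icc 0 T := fun τ hτ => ⟨hτ.1, hτ.2.trans ht.2⟩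
  have hhalf : ∀ τ ∈ Icc 0 t, b / 2 ≤ rate a δ b τ := fun τ hτ =>
    half_le_rate hδ hb ((hmem τ hτ).2.trans hT)
  have hb2 : 0 < b / 2 := half_pos hb
  have hu' : ∀ τ ∈ Icc 0 t, GaussianBound (b / 2) M (u τ) := fun τ hτ =>
    (hu τ (hmem τ hτ)).mono (hhalf τ hτ) le_rfl
  have hw' : ∀ τ ∈ Icc 0 t, GaussianBound (b / 2) M (w τ) := fun τ hτ =>
    (hw τ (hmem τ hτ)).mono (hhalf τ hτ) le_rfl
  have hiu := intervalIntegrable_transport_collision hb2 ht.1 hum hu' z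
  have hiw := intervalIntegrable_transport_collision hb2 ht.1 hwm hw' z
  have e1 : mildMap f₀ u t z - mildMap f₀ w t z = ∫ τ in (0 : ℝ)..t,
      (transport (t - τ) (collision (u τ)) z - transport (t - τ) (collision (w τ)) z) := by
    rw [intervalIntegral.integral_sub hiu hiw]
    unfold mildMap duhamel
    ring
  have e2 : ∫ τ in (0 : ℝ)..a,
      (transport (t - τ) (collision (u τ)) z - transport (t - τ) (collision (w τ)) z) = 0 := by
    refine intervalIntegral.integral_zero_ae ?_
    -- Agreement is assumed on `[0,a)` only, so the endpoint is discarded as a null set; this also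
    -- covers `a = 0`.
    filter_upwards [Measure.ae_ne volume a] with τ hτ h
    rw [uIoc_of_le ha] at h
    rw [heq τ ⟨h.1.le, lt_of_le_of_ne h.2 hτ⟩, sub_self]
  have hi := hiu.sub hiw
  have hsub1 : uIcc 0 a ⊆ uIcc 0 t := by
    rw [uIcc_of_le ha, uIcc_of_le ht.1]; exact Icc_subset_Icc le_rfl hat
  have hsub2 : uIcc a t ⊆ uIcc 0 t := by
    rw [uIcc_of_le hat, uIcc_of_le ht.1]; exact Icc_subset_Icc ha le_rfl
  rw [e1, ← intervalIntegral.integral_add_adjacent_intervals (hi.mono_set hsub1)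
    (hi.mono_set hsub2), e2, zero_add]
  set c := b / (2 * δ) with hcdef
  have hc : 0 < c := by positivity
  set V := ‖z.2‖ with hV
  set K := collisionConst (b / 2) with hK
  have hK0 : 0 ≤ K := collisionConst_nonneg _
  set E := Real.exp (-(rate a δ b t / 2) * V ^ 2) with hE
  have hE0 : 0 < E := Real.exp_pos _
  have hbound : ∀ τ ∈ Ioc a t,
      |transport (t - τ) (collision (u τ)) z - transport (t - τ) (collision (w τ)) z| ≤
      4 * D * M * K * E * (2 + V ^ 2 * Real.exp (-(c / 2 * V ^ 2 * (t - τ)))) := by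
    intro τ hτ
    have hτ0 : τ ∈ Icc 0 t := ⟨ha.trans hτ.1.le, hτ.2⟩
    have hum' : Measurable (u τ) := hum.comp measurable_prodMk_left
    have hwm' : Measurable (w τ) := hwm.comp measurable_prodMk_left
    have hr : 0 < rate a δ b τ := hb2.trans_le (hhalf τ hτ0)
    have hcu : Measurable (collision (u τ)) := (measurable_collision hum).comp measurable_prodMk_left
    have hcw : Measurable (collision (w τ)) := (measurable_collision hwm).comp measurable_prodMk_left
    have hwt : ∀ y : Phase, ‖y.2‖ = ‖z.2‖ → ∀ r, weight r y.2 = weight r z.2 := fun y hy r => by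
      unfold weight; rw [hy]
    rw [transport_sub (B := 2 * M * M * K * weight (b / 2) z.2) _ hcu hcw
      (fun y hy => by rw [← hwt y hy]; exact abs_collision_le hb2 (hu' τ hτ0) y)
      (fun y hy => by rw [← hwt y hy]; exact abs_collision_le hb2 (hw' τ hτ0) y)]
    refine abs_transport_le _ fun y hy => ?_
    have h1 := abs_collision_sub_le hr hum' hwm' (hu τ (hmem τ hτ0)) (hw τ (hmem τ hτ0))
      (huw τ (hmem τ hτ0)) y
    rw [hwt y hy] at h1
    have h2 : collisionConst (rate a δ b τ) ≤ K := collisionConst_anti hb2 (hhalf τ hτ0)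
    have h3 : weight (rate a δ b τ) z.2 ≤
        E * (2 + V ^ 2 * Real.exp (-(c / 2 * V ^ 2 * (t - τ)))) := by
      -- On `[a,t]` the rate is affine with slope `-c`, so `rate τ - rate t = c * (t - τ)`.
      have hexp : Real.exp (-(rate a δ b τ / 2) * V ^ 2) =
          E * Real.exp (-(c / 2 * V ^ 2 * (t - τ))) := by
        rw [hE, ← Real.exp_add]
        congr 1
        unfold rate
        rw [max_eq_left (sub_nonneg.2 hτ.1.le), max_eq_left (sub_nonneg.2 hat), ← hcdef]
        ring
      have hle : Real.exp (-(c / 2 * V ^ 2 * (t - τ))) ≤ 1 := Real.exp_le_one_iff.2 (by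
        have : 0 ≤ c / 2 * V ^ 2 * (t - τ) :=
          mul_nonneg (by positivity) (sub_nonneg.2 hτ.2)
        linarith)
      have h4 : 1 + V ≤ 2 + V ^ 2 := by nlinarith [sq_nonneg (V - 1), norm_nonneg z.2]
      have hp := Real.exp_pos (-(c / 2 * V ^ 2 * (t - τ)))
      unfold weight
      rw [← hV, hexp, mul_left_comm]
      refine mul_le_mul_of_nonneg_left ?_ hE0.le
      nlinarith
    calc _ ≤ 4 * D * M * collisionConst (rate a δ b τ) * weight (rate a δ b τ) z.2 := h1
      _ ≤ 4 * D * M * K * (E * (2 + V ^ 2 * Real.exp (-(c / 2 * V ^ 2 * (t - τ))))) := by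
        have := weight_nonneg (rate a δ b τ) z.2
        gcongr
      _ = _ := by ring
  have h5 := intervalIntegral.norm_integral_le_of_norm_le (μ := volume) hat
    (f := fun τ => transport (t - τ) (collision (u τ)) z - transport (t - τ) (collision (w τ)) z)
    (Filter.Eventually.of_forall fun τ hτ => hbound τ hτ)
    (Continuous.intervalIntegrable (by fun_prop) a t)
  rw [Real.norm_eq_abs, intervalIntegral.integral_const_mul] at h5
  have h6 := integral_rate_le (a := a) (t := t) (V := V) hc
  have h7 : 2 * (t - a) + 2 / c ≤ 2 * δ + 4 * δ / b := by
    have e : 2 / c = 4 * δ / b := by rw [hcdef]; field_simp; norm_num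
    have := ht.2.trans hT
    rw [e]; linarith
  calc _ ≤ 4 * D * M * K * E * (2 * δ + 4 * δ / b) :=
        h5.trans (mul_le_mul_of_nonneg_left (h6.trans h7) (by positivity))
    _ = D * (4 * M * K * (2 * δ + 4 * δ / b)) * E := by ring
    _ ≤ D * (1 / 2) * E := by gcongr
    _ = _ := by ring

/-! ### Existence -/

/-- Iterates of the mild map. -/
def mildSeq (f₀ : Phase → ℝ) (w : ℝ → Phase → ℝ) : ℕ → ℝ → Phase → ℝ
  | 0 => w
  | n + 1 => mildMap f₀ (mildSeq f₀ w n)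

theorem measurable_mildSeq {f₀ : Phase → ℝ} (hf : Measurable f₀) {w : ℝ → Phase → ℝ}
    (hw : Measurable fun p : ℝ × Phase => w p.1 p.2) (n : ℕ) :
    Measurable fun p : ℝ × Phase => mildSeq f₀ w n p.1 p.2 := by
  induction n with
  | zero => exact hw
  | succ n ih => exact measurable_mildMap hf ih

theorem mildMap_zero_fun (f₀ : Phase → ℝ) (t : ℝ) (z : Phase) :
    mildMap f₀ (fun _ _ => 0) t z = transport t f₀ z := by
  simp [mildMap, duhamel, collision, collisionGain, collisionLoss, transport]

theorem GaussianBound.add {b A B : ℝ} {g h : Phase → ℝ} (hg : GaussianBound b A g)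
    (hh : GaussianBound b B h) : GaussianBound b (A + B) (fun z => g z + h z) := fun z => by
  rw [add_mul]
  exact (abs_add_le _ _).trans (add_le_add (hg z) (hh z))

theorem GaussianBound.of_sub {b A B : ℝ} {g h : Phase → ℝ} (hg : GaussianBound b A g)
    (hh : GaussianBound b B (fun z => h z - g z)) : GaussianBound b (A + B) h := fun z => by
  have := (hg.add hh) z
  simpa using this

theorem measurable_comp_projIcc {T : ℝ} (hT : 0 ≤ T) {u : ℝ → Phase → ℝ}
    (hm : Measurable fun p : Icc (0 : ℝ) T × Phase => u p.1 p.2) :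
    Measurable fun p : ℝ × Phase => u (projIcc 0 T hT p.1) p.2 :=
  Measurable.comp (f := fun p : ℝ × Phase => (projIcc 0 T hT p.1, p.2)) hm
    (((continuous_projIcc (h := hT)).comp continuous_fst).measurable.prodMk measurable_snd)

/-- Picard iteration from zero in the ball of radius `2 * C` of the time-dependent Gaussian norm.
Pointwise limits of the iterates keep measurability and the bounds. -/
theorem exists_isSolution {β C : ℝ} (hβ : 0 < β) (hC : 0 ≤ C) {δ : ℝ} (hδ : 0 < δ)
    (hsmall : 4 * (2 * C) * collisionConst (β / 2) * (2 * δ + 4 * δ / β) ≤ 1 / 2)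
    {f₀ : Phase → ℝ} (hf : Measurable f₀) (hG : GaussianBound β C f₀) :
    ∃ f : ℝ → Phase → ℝ, IsSolution δ f₀ f := by
  set u : ℕ → ℝ → Phase → ℝ := mildSeq f₀ (fun _ _ => 0) with hu
  have hus : ∀ n t z, u (n + 1) t z = mildMap f₀ (u n) t z := fun n t z => rfl
  have hum : ∀ n, Measurable fun p : ℝ × Phase => u n p.1 p.2 :=
    measurable_mildSeq hf measurable_const
  have hδ' : δ ≤ 0 + δ := by rw [zero_add]
  have hzero : ∀ b : ℝ, GaussianBound b (2 * C) (fun _ => 0) := fun b z => by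
    rw [abs_zero]; positivity
  have hbd : ∀ n, ∀ τ ∈ Icc 0 δ, GaussianBound (rate 0 δ β τ) (2 * C) (u n τ) := by
    intro n
    induction n with
    | zero => exact fun τ _ => hzero _
    | succ n ih =>
      intro τ hτ
      have h1 := mildMap_contraction (a := 0) (D := 2 * C) le_rfl hδ hβ hsmall hδ' (hum n)
        (w := fun _ _ => 0) measurable_const ih (fun _ _ => hzero _) (by simpa using ih)
        (fun τ h => absurd h.2 (not_lt.2 h.1)) f₀ hτ
      have h2 : GaussianBound (rate 0 δ β τ) C (mildMap f₀ (fun _ _ => 0) τ) := by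
        have := (hG.transport τ).mono (rate_le hδ hβ τ : rate 0 δ β τ ≤ β) le_rfl
        intro z
        rw [mildMap_zero_fun]
        exact this z
      have h3 := h2.of_sub h1
      -- The ball is invariant: the free part costs `C`, and contraction against the zero function
      -- costs half the radius.
      have e : C + 2 * C / 2 = 2 * C := by ring
      rwa [e] at h3
  have hdiff : ∀ n, ∀ τ ∈ Icc 0 δ,
      GaussianBound (rate 0 δ β τ) (2 * C / 2 ^ n) (fun z => u (n + 1) τ z - u n τ z) := by
    intro n
    induction n with
    | zero =>
      intro τ hτ z
      have := hbd 1 τ hτ z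
      simpa [hu, mildSeq] using this
    | succ n ih =>
      intro τ hτ
      have h1 := mildMap_contraction (a := 0) le_rfl hδ hβ hsmall hδ' (hum (n + 1)) (hum n)
        (hbd (n + 1)) (hbd n) ih (fun τ h => absurd h.2 (not_lt.2 h.1)) f₀ hτ
      rwa [div_div, ← pow_succ] at h1
  have hnn : ∀ τ ∈ Icc 0 δ, 0 ≤ rate 0 δ β τ := fun τ hτ =>
    (half_pos hβ).le.trans (half_le_rate hδ hβ (by linarith [hτ.2]))
  have hdist : ∀ τ ∈ Icc 0 δ, ∀ z n, dist (u n τ z) (u (n + 1) τ z) ≤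
      (4 * C * Real.exp (-(rate 0 δ β τ / 2) * ‖z.2‖ ^ 2)) / 2 / 2 ^ n := fun τ hτ z n => by
    rw [dist_comm, Real.dist_eq]
    refine (hdiff n τ hτ z).trans (le_of_eq ?_)
    ring
  have hlim : ∀ τ ∈ Icc 0 δ, ∀ z, Filter.Tendsto (fun n => u n τ z) Filter.atTop
      (nhds (Filter.limUnder Filter.atTop fun n => u n τ z)) := fun τ hτ z =>
    (cauchySeq_of_le_geometric_two (hdist τ hτ z)).tendsto_limUnder
  set f : ℝ → Phase → ℝ := fun t z =>
    Filter.limUnder Filter.atTop fun n => u n (projIcc 0 δ hδ.le t) z with hfdef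
  have hfe : ∀ τ ∈ Icc 0 δ, ∀ z, f τ z = Filter.limUnder Filter.atTop fun n => u n τ z := fun τ hτ z => by
    rw [hfdef]; simp only [projIcc_of_mem hδ.le hτ]
  have hfm : Measurable fun p : ℝ × Phase => f p.1 p.2 := by
    refine measurable_of_tendsto_metrizable
      (f := fun n (p : ℝ × Phase) => u n (projIcc 0 δ hδ.le p.1) p.2) (fun n => ?_)
      (tendsto_pi_nhds.2 fun p => hlim _ (projIcc 0 δ hδ.le p.1).2 p.2)
    exact measurable_comp_projIcc hδ.le ((hum n).comp
      ((measurable_subtype_coe.comp measurable_fst).prodMk measurable_snd))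
  have hlim' : ∀ τ ∈ Icc 0 δ, ∀ z, Filter.Tendsto (fun n => u n τ z) Filter.atTop
      (nhds (f τ z)) := fun τ hτ z => by rw [hfe τ hτ]; exact hlim τ hτ z
  have hfb : ∀ τ ∈ Icc 0 δ, GaussianBound (rate 0 δ β τ) (2 * C) (f τ) := fun τ hτ z =>
    le_of_tendsto (hlim' τ hτ z).abs (Filter.Eventually.of_forall fun n => hbd n τ hτ z)
  have hfd : ∀ n, ∀ τ ∈ Icc 0 δ,
      GaussianBound (rate 0 δ β τ) (4 * C / 2 ^ n) (fun z => u n τ z - f τ z) := fun n τ hτ z => by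
    have h := dist_le_of_le_geometric_two_of_tendsto (hdist τ hτ z) (hlim' τ hτ z) n
    rw [Real.dist_eq] at h
    refine h.trans (le_of_eq ?_)
    ring
  refine ⟨f, ⟨?_, ⟨β / 2, half_pos hβ, 2 * C, fun t ht => ?_⟩, fun t ht z => ?_⟩⟩
  · exact Measurable.comp (g := fun p : ℝ × Phase => f p.1 p.2)
      (f := fun p : Icc (0 : ℝ) δ × Phase => ((p.1 : ℝ), p.2)) hfm
      ((measurable_subtype_coe.comp measurable_fst).prodMk measurable_snd)
  · exact (hfb t ht).mono (half_le_rate hδ hβ (by linarith [ht.2])) le_rfl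
  · show f t z = mildMap f₀ f t z
    have h1 : Filter.Tendsto (fun n => u (n + 1) t z) Filter.atTop (nhds (f t z)) :=
      (hlim' t ht z).comp (Filter.tendsto_add_atTop_nat 1)
    -- The contraction estimate, applied to an iterate and the limit, passes the limit through the
    -- mild map.
    have h2 : Filter.Tendsto (fun n => u (n + 1) t z) Filter.atTop (nhds (mildMap f₀ f t z)) := by
      rw [tendsto_iff_dist_tendsto_zero]
      have h3 : Filter.Tendsto (fun n : ℕ => 4 * C / 2 ^ n / 2) Filter.atTop (nhds 0) := by
        have := (tendsto_pow_atTop_nhds_zero_of_lt_one (r := (1 / 2 : ℝ)) (by norm_num)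
          (by norm_num)).const_mul (4 * C / 2)
        rw [mul_zero] at this
        refine this.congr fun n => ?_
        rw [one_div, inv_pow]; ring
      refine squeeze_zero (fun _ => dist_nonneg) (fun n => ?_) h3
      have h4 := mildMap_contraction (a := 0) le_rfl hδ hβ hsmall hδ' (hum n) hfm
        (hbd n) hfb (hfd n) (fun τ h => absurd h.2 (not_lt.2 h.1)) f₀ ht
      rw [Real.dist_eq, hus]
      exact h4.abs_le (hnn t ht) z
    exact tendsto_nhds_unique h1 h2

/-! ### Uniqueness and continuity -/

/-- The frozen extension of a solution to all times. -/
def clampTime (T : ℝ) (hT : 0 ≤ T) (f : ℝ → Phase → ℝ) (t : ℝ) : Phase → ℝ :=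
  f (projIcc 0 T hT t)

theorem clampTime_of_mem {T : ℝ} (hT : 0 ≤ T) (f : ℝ → Phase → ℝ) {t : ℝ} (ht : t ∈ Icc 0 T) :
    clampTime T hT f t = f t := by
  rw [clampTime, projIcc_of_mem hT ht]

theorem IsSolution.measurable_clampTime {T : ℝ} (hT : 0 ≤ T) {f₀ : Phase → ℝ}
    {f : ℝ → Phase → ℝ} (hf : IsSolution T f₀ f) :
    Measurable fun p : ℝ × Phase => clampTime T hT f p.1 p.2 :=
  measurable_comp_projIcc hT hf.measurable

theorem IsSolution.clampTime_eq {T : ℝ} (hT : 0 ≤ T) {f₀ : Phase → ℝ}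
    {f : ℝ → Phase → ℝ} (hf : IsSolution T f₀ f) {t : ℝ} (ht : t ∈ Icc 0 T) (z : Phase) :
    clampTime T hT f t z = mildMap f₀ (clampTime T hT f) t z := by
  rw [clampTime_of_mem hT f ht, hf.mild t ht z]
  exact mildMap_congr ht.1 f₀ (fun τ hτ =>
    (clampTime_of_mem hT f ⟨hτ.1, hτ.2.trans ht.2⟩).symm) z

theorem eq_zero_of_forall_le_div_pow {x A : ℝ} (h : ∀ n : ℕ, |x| ≤ A / 2 ^ n) : x = 0 := by
  have h1 : Filter.Tendsto (fun n : ℕ => A / 2 ^ n) Filter.atTop (nhds 0) := by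
    have := (tendsto_pow_atTop_nhds_zero_of_lt_one (r := (1 / 2 : ℝ)) (by norm_num)
      (by norm_num)).const_mul A
    rw [mul_zero] at this
    refine this.congr fun n => ?_
    rw [one_div, inv_pow]; ring
  exact abs_nonpos_iff.1 (ge_of_tendsto' h1 h)

/-- Both solutions are fixed points within a common bound `b`, `M` on all of `[0,T]`, so the
contraction step `δ` does not shrink as agreement is extended from `k * δ` to `(k + 1) * δ`. -/
theorem IsSolution.unique {T : ℝ} {f₀ : Phase → ℝ} {f g : ℝ → Phase → ℝ}
    (hf : IsSolution T f₀ f) (hg : IsSolution T f₀ g) : ∀ t ∈ Icc 0 T, g t = f t := by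
  rcases lt_or_ge T 0 with hT | hT
  · exact fun t ht => absurd (ht.1.trans ht.2) (not_le.2 hT)
  obtain ⟨b₁, hb₁, M₁, h₁⟩ := hf.gaussian
  obtain ⟨b₂, hb₂, M₂, h₂⟩ := hg.gaussian
  set b := min b₁ b₂ with hbdef
  set M := max M₁ M₂ with hMdef
  have hb : 0 < b := lt_min hb₁ hb₂
  have hM : 0 ≤ M := ((h₁ 0 ⟨le_rfl, hT⟩).nonneg).trans (le_max_left _ _)
  obtain ⟨δ, hδ, hsmall⟩ := exists_contraction_step hb hM
  set u := clampTime T hT f with hu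
  set w := clampTime T hT g with hw
  have hub : ∀ t, GaussianBound b M (u t) := fun t =>
    (h₁ _ (projIcc 0 T hT t).2).mono (min_le_left _ _) (le_max_left _ _)
  have hwb : ∀ t, GaussianBound b M (w t) := fun t =>
    (h₂ _ (projIcc 0 T hT t).2).mono (min_le_right _ _) (le_max_right _ _)
  have key : ∀ k : ℕ, ∀ t ∈ Icc 0 (min (k * δ) T), w t = u t := by
    intro k
    induction k with
    | zero =>
      intro t ht
      have ht0 : t = 0 := le_antisymm (by simpa [hT] using ht.2) ht.1
      funext z
      rw [hw, hu, hg.clampTime_eq hT ⟨ht.1, ht.2.trans (min_le_right _ _)⟩,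
        hf.clampTime_eq hT ⟨ht.1, ht.2.trans (min_le_right _ _)⟩, ht0]
      simp [mildMap, duhamel]
    | succ k ih =>
      set a := min (k * δ) T with ha
      set T' := min (((k + 1 : ℕ) : ℝ) * δ) T with hT'
      have ha0 : 0 ≤ a := le_min (by positivity) hT
      have hTa : T' ≤ a + δ := by
        rw [ha, min_add]
        refine min_le_min (by push_cast; linarith) (by linarith)
      -- The rate restarts from `b` at time `a`. The crude bound `2 * M` on the difference is halved
      -- each time the fixed-point equation is used.
      have hit : ∀ n : ℕ, ∀ τ ∈ Icc 0 T',
          GaussianBound (rate a δ b τ) (2 * M / 2 ^ n) (fun z => w τ z - u τ z) := by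
        intro n
        induction n with
        | zero =>
          intro τ _ z
          have h3 := ((hwb τ).mono (rate_le hδ hb τ : rate a δ b τ ≤ b) le_rfl) z
          have h4 := ((hub τ).mono (rate_le hδ hb τ : rate a δ b τ ≤ b) le_rfl) z
          refine (abs_sub _ _).trans ?_
          rw [pow_zero, div_one, two_mul, add_mul]
          exact add_le_add h3 h4
        | succ n ihn =>
          intro τ hτ z
          have h3 := mildMap_contraction ha0 hδ hb hsmall hTa (hg.measurable_clampTime hT)
            (hf.measurable_clampTime hT)
            (fun τ _ => (hwb τ).mono (rate_le hδ hb τ : rate a δ b τ ≤ b) le_rfl)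
            (fun τ _ => (hub τ).mono (rate_le hδ hb τ : rate a δ b τ ≤ b) le_rfl) ihn
            (fun τ hτ => ih τ ⟨hτ.1, hτ.2.le⟩) f₀ hτ z
          rw [div_div, ← pow_succ] at h3
          have hτT : τ ∈ Icc 0 T := ⟨hτ.1, hτ.2.trans (min_le_right _ _)⟩
          show |w τ z - u τ z| ≤ _
          rw [hw, hu, hg.clampTime_eq hT hτT, hf.clampTime_eq hT hτT]
          exact h3
      intro t ht
      funext z
      refine sub_eq_zero.1 (eq_zero_of_forall_le_div_pow (A := 2 * M) fun n => ?_)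
      exact (hit n t ht).abs_le ((half_pos hb).le.trans
        (half_le_rate hδ hb (ht.2.trans hTa))) z
  intro t ht
  obtain ⟨k, hk⟩ := exists_nat_ge (T / δ)
  rw [div_le_iff₀ hδ] at hk
  have := key k t ⟨ht.1, le_min (ht.2.trans hk) ht.2⟩
  rwa [hw, hu, clampTime_of_mem hT g ht, clampTime_of_mem hT f ht] at this

/-- Continuity of a solution is propagated over one contraction step. -/
theorem IsSolution.continuousOn_step {T : ℝ} (hT : 0 ≤ T) {f₀ : Phase → ℝ} {f : ℝ → Phase → ℝ}
    (hf : IsSolution T f₀ f) {B : ℝ} (hf₀ : Continuous f₀) (hd : DiffuseCondition f₀)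
    (hB : ∀ z, |f₀ z| ≤ B) {b M δ : ℝ} (hb : 0 < b) (hM : 0 ≤ M) (hδ : 0 < δ)
    (hsmall : 4 * (3 * M) * collisionConst (b / 2) * (2 * δ + 4 * δ / b) ≤ 1 / 2)
    (hub : ∀ t, GaussianBound b M (clampTime T hT f t)) {a T' : ℝ} (ha0 : 0 ≤ a) (haT : a ≤ T)
    (haT' : a ≤ T') (hT'T : T' ≤ T) (hTa : T' ≤ a + δ)
    (hc : ContinuousOn (fun p : ℝ × Phase => clampTime T hT f p.1 p.2) (domain a)) :
    ContinuousOn (fun p : ℝ × Phase => clampTime T hT f p.1 p.2) (domain T') := by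
  set u := clampTime T hT f with hu
  have hum : Measurable fun p : ℝ × Phase => u p.1 p.2 := hf.measurable_clampTime hT
  -- Freezing the solution at time `a` gives a first iterate that is continuous on the longer
  -- interval and agrees with `u` up to `a`, as the contraction requires.
  set w := mildSeq f₀ (fun τ => u (min τ a)) with hw
  have hwm : ∀ n, Measurable fun p : ℝ × Phase => w n p.1 p.2 :=
    measurable_mildSeq hf₀.measurable
      (hum.comp (Measurable.prodMk (measurable_fst.min measurable_const) measurable_snd))
  have hue : ∀ τ ∈ Icc 0 T, ∀ z, u τ z = mildMap f₀ u τ z := fun τ hτ z => hf.clampTime_eq hT hτ z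
  have heq : ∀ n, ∀ τ ∈ Icc 0 a, w n τ = u τ := by
    intro n
    induction n with
    | zero => intro τ hτ; rw [hw, mildSeq, min_eq_left hτ.2]
    | succ n ih =>
      intro τ hτ
      funext z
      rw [hue τ ⟨hτ.1, hτ.2.trans haT⟩]
      exact mildMap_congr hτ.1 f₀ (fun s hs => ih s ⟨hs.1, hs.2.trans hτ.2⟩) z
  have hub' : ∀ τ, GaussianBound (rate a δ b τ) M (u τ) := fun τ =>
    (hub τ).mono (rate_le hδ hb τ) le_rfl
  -- The iterates are within `2 * M` of `u`, which is bounded by `M`; hence the `3 * M` in `hsmall`.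
  have hub3 : ∀ τ, GaussianBound (rate a δ b τ) (3 * M) (u τ) := fun τ =>
    (hub' τ).mono le_rfl (by linarith)
  have hit : ∀ n, ∀ τ ∈ Icc 0 T',
      GaussianBound (rate a δ b τ) (2 * M / 2 ^ n) (fun z => w n τ z - u τ z) := by
    intro n
    induction n with
    | zero =>
      intro τ _ z
      have h3 := ((hub (min τ a)).mono (rate_le hδ hb τ : rate a δ b τ ≤ b) le_rfl) z
      refine (abs_sub _ _).trans ?_
      rw [pow_zero, div_one, two_mul, add_mul]
      exact add_le_add h3 (hub' τ z)
    | succ n ihn =>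
      intro τ hτ z
      have hwb : ∀ τ ∈ Icc 0 T', GaussianBound (rate a δ b τ) (3 * M) (w n τ) := fun τ hτ => by
        refine ((hub' τ).of_sub (ihn τ hτ)).mono le_rfl ?_
        have : 2 * M / 2 ^ n ≤ 2 * M :=
          div_le_self (by positivity) (one_le_pow₀ one_le_two)
        linarith
      have h3 := mildMap_contraction ha0 hδ hb hsmall hTa (hwm n) hum hwb
        (fun τ _ => hub3 τ) ihn (fun τ hτ => heq n τ ⟨hτ.1, hτ.2.le⟩) f₀ hτ z
      rw [div_div, ← pow_succ] at h3
      show |w (n + 1) τ z - u τ z| ≤ _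
      rw [hue τ ⟨hτ.1, hτ.2.trans hT'T⟩]
      exact h3
  have hhalf : ∀ τ ∈ Icc 0 T', b / 2 ≤ rate a δ b τ := fun τ hτ =>
    half_le_rate hδ hb (hτ.2.trans hTa)
  have hwc : ∀ n, ContinuousOn (fun p : ℝ × Phase => w n p.1 p.2) (domain T') := by
    intro n
    induction n with
    | zero =>
      refine ContinuousOn.comp (t := domain a) (f := fun p : ℝ × Phase => (min p.1 a, p.2)) hc
        (by fun_prop) fun p hp => ⟨⟨le_min hp.1.1 ha0, min_le_right _ _⟩, hp.2⟩
    | succ n ih =>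
      refine continuousOn_mildMap (ha0.trans haT') (half_pos hb) hf₀ hd hB (hwm n)
        (M := M + 2 * M / 2 ^ n) (fun τ hτ => ?_) ih
      exact ((hub' τ).of_sub (hit n τ hτ)).mono (hhalf τ hτ) le_rfl
  have hunif : TendstoUniformlyOn (fun n (p : ℝ × Phase) => w n p.1 p.2)
      (fun p => u p.1 p.2) Filter.atTop (domain T') := by
    rw [Metric.tendstoUniformlyOn_iff]
    intro ε hε
    obtain ⟨N, hN⟩ := exists_pow_lt_of_lt_one (y := (1 / 2 : ℝ))
      (show 0 < ε / (2 * M + 1) by positivity) (by norm_num)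
    filter_upwards [Filter.eventually_ge_atTop N] with n hn p hp
    rw [dist_comm, Real.dist_eq]
    refine ((hit n p.1 hp.1).abs_le ((half_pos hb).le.trans (hhalf _ hp.1)) p.2).trans_lt ?_
    rw [lt_div_iff₀ (by positivity)] at hN
    have h4 : (1 / 2 : ℝ) ^ n ≤ (1 / 2) ^ N :=
      pow_le_pow_of_le_one (by norm_num) (by norm_num) hn
    have h5 : 2 * M / 2 ^ n = 2 * M * (1 / 2) ^ n := by rw [one_div, inv_pow]; ring
    rw [h5]
    have h6 : 0 < (1 / 2 : ℝ) ^ N := by positivity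
    nlinarith [mul_le_mul_of_nonneg_left h4 (by positivity : 0 ≤ 2 * M)]
  exact hunif.continuousOn (Filter.Frequently.of_forall hwc)

theorem IsSolution.continuousOn {T : ℝ} {f₀ : Phase → ℝ} {f : ℝ → Phase → ℝ}
    (hf : IsSolution T f₀ f) {B : ℝ} (hf₀ : Continuous f₀) (hd : DiffuseCondition f₀)
    (hB : ∀ z, |f₀ z| ≤ B) :
    ContinuousOn (fun p : ℝ × Phase => f p.1 p.2) (Icc 0 T ×ˢ grazingᶜ) := by
  rcases lt_or_ge T 0 with hT | hT
  · rw [Icc_eq_empty (not_le.2 hT), empty_prod]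
    exact continuousOn_empty _
  obtain ⟨b, hb, M, hG⟩ := hf.gaussian
  have hM : 0 ≤ M := (hG 0 ⟨le_rfl, hT⟩).nonneg
  obtain ⟨δ, hδ, hsmall⟩ := exists_contraction_step hb (by positivity : 0 ≤ 3 * M)
  have hub : ∀ t, GaussianBound b M (clampTime T hT f t) := fun t => hG _ (projIcc 0 T hT t).2
  have key : ∀ k : ℕ, ContinuousOn (fun p : ℝ × Phase => clampTime T hT f p.1 p.2)
      (domain (min (k * δ) T)) := by
    intro k
    induction k with
    | zero =>
      -- At time zero the Duhamel term vanishes and the solution is the transported datum.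
      have h0 : min (((0 : ℕ) : ℝ) * δ) T = 0 := by simpa using hT
      rw [h0]
      refine (continuousOn_transport hf₀ hd hB).congr fun p hp => ?_
      have hp0 : p.1 = 0 := le_antisymm hp.1.2 hp.1.1
      show clampTime T hT f p.1 p.2 = transport p.1 f₀ p.2
      rw [hf.clampTime_eq hT ⟨hp.1.1, hp.1.2.trans hT⟩, hp0]
      simp [mildMap, duhamel]
    | succ k ih =>
      refine hf.continuousOn_step hT hf₀ hd hB hb hM hδ hsmall hub
        (le_min (by positivity) hT) (min_le_right _ _) ?_ (min_le_right _ _) ?_ ih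
      · exact min_le_min (by push_cast; linarith) le_rfl
      · rw [min_add]
        exact min_le_min (by push_cast; linarith) (by linarith)
  obtain ⟨k, hk⟩ := exists_nat_ge (T / δ)
  rw [div_le_iff₀ hδ] at hk
  have h := key k
  rw [min_eq_right hk] at h
  exact h.congr fun p hp => by simp only [clampTime_of_mem hT f hp.1]

end DiffuseBoltzmann

end

theorem mainTheorem6 (β C : ℝ) (hβ : 0 < β) :
    (∃ T : ℝ, 0 < T ∧ ∀ f₀ : DiffuseBoltzmann.Phase → ℝ, Continuous f₀ →
      DiffuseBoltzmann.GaussianBound β C f₀ → DiffuseBoltzmann.DiffuseCondition f₀ →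
      ∃ f : ℝ → DiffuseBoltzmann.Phase → ℝ, DiffuseBoltzmann.IsSolution T f₀ f) ∧
    ∀ f₀ : DiffuseBoltzmann.Phase → ℝ, Continuous f₀ →
      DiffuseBoltzmann.GaussianBound β C f₀ → DiffuseBoltzmann.DiffuseCondition f₀ →
      ∀ (T : ℝ) (f : ℝ → DiffuseBoltzmann.Phase → ℝ), DiffuseBoltzmann.IsSolution T f₀ f →
        (∀ g : ℝ → DiffuseBoltzmann.Phase → ℝ, DiffuseBoltzmann.IsSolution T f₀ g →
          ∀ t ∈ Set.Icc (0 : ℝ) T, g t = f t) ∧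
        ContinuousOn (fun p : ℝ × DiffuseBoltzmann.Phase => f p.1 p.2)
          (Set.Icc (0 : ℝ) T ×ˢ DiffuseBoltzmann.grazingᶜ) := by
  constructor
  -- The existence time is fixed before `f₀` is given. The factor `2` is the radius of the invariant
  -- ball, and `|C|` takes care of the sign of `C`.
  · obtain ⟨δ, hδ, hsmall⟩ := DiffuseBoltzmann.exists_contraction_step hβ
      (by positivity : 0 ≤ 2 * |C|)
    exact ⟨δ, hδ, fun f₀ hf hG _ => DiffuseBoltzmann.exists_isSolution hβ (abs_nonneg C) hδ hsmall
      hf.measurable (hG.mono le_rfl (le_abs_self C))⟩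
  · intro f₀ hf hG hd T f hfs
    exact ⟨fun g hg => hfs.unique hg, hfs.continuousOn hf hd fun z => hG.abs_le hβ.le z⟩
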